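/- **Setting.** Let $A_0$ be a $\sigma$-unital C*-algebra (one with a countable approximate identity of positive contractions). Let $K(A_0)$ be its Pedersen ideal, the minimum dense two-sided ideal of $A_0$, and let $\Gamma(K(A_0))$ be the unital $*$-algebra of all pairs $(S,T)$ of maps $S,T:K(A_0)\to K(A_0)$ with $x\,S(y)=T(x)\,y$ for all $x,y\in K(A_0)$ (such maps are automatically linear), with pointwise linear operations, product $(S,T)(U,V)=(SU,VT)$ and involution $(S,T)^*=(T^\sharp,S^\sharp)$, where $S^\sharp(x)=S(x^*)^*$. For $a\in A_0$ put $L_a=\overline{A_0a}$ and $R_a=\overline{aA_0}$. Let $\Gamma(K(A_0))$ carry its projective topology, given by the seminorms $(S,T)\mapsto\|S|_{L_a}\|=\sup\{\|S(ba)\| : b\in A_0,\ \|ba\|\le 1\}$, for positive $a\in K(A_0)$. The algebra $A_0$ embeds in $\Gamma(K(A_0))$ by $a\mapsto(x\mapsto ax,\ x\mapsto xa)$. A canonical approximate identity of $A_0$ is a sequence $(e_n)$ in $A_0$ with $e_n\ge 0$, $\|e_n\|\le 1$, $e_ne_{n+1}=e_n$ for all $n$, and $e_na\to a$, $ae_n\to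 a$ for all $a\in A_0$ (then $e_n\in K(A_0)$ automatically). For such a sequence let $M_{e_n}$ be the C*-algebra of all pairs $(S,T)$ of linear maps $S:L_{e_n}\to L_{e_n}$, $T:R_{e_n}\to R_{e_n}$ with $y\,S(x)=T(y)\,x$ for $x\in L_{e_n}$, $y\in R_{e_n}$ (such maps are automatically bounded), with the norm $\|(S,T)\|=\|S\|$ and operations as above. Let $$\varphi_n:\Gamma(K(A_0))\to M_{e_n},\qquad \varphi_n(S,T)=(S|_{L_{e_n}},T|_{R_{e_n}}),$$ and let $B_n=\varphi_n(A_0)$, a C*-subalgebra of $M_{e_n}$, with multiplier algebra $M(B_n)$. For every $x\in\Gamma(K(A_0))$ one has $\varphi_n(x)B_n\subseteq B_n$ and $B_n\varphi_n(x)\subseteq B_n$, so that $\varphi_n(x)$ defines by left and right multiplication an element of $M(B_n)$; this gives the canonical $*$-homomorphism $\varphi_n:\Gamma(K(A_0))\to M(B_n)$. For $n\le m$ restriction gives a surjective $*$-homomorphism $\varphi_{nm}:B_m\to B_n$, $\varphi_m(a)\mapsto\varphi_n(a)$, and $\varphi_{nm}:M(B_m)\to M(B_n)$ denotes its unique extension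 to the multiplier algebras. **Proposition 3.2.** Every $\sigma$-unital C*-algebra $A_0$ has a canonical approximate identity. For every canonical approximate identity $(e_n)$ of $A_0$, the map $x\mapsto(\varphi_n(x))_n$ is an isomorphism of $\sigma$-C*-algebras $$\Gamma(K(A_0))\;\cong\;\varprojlim_n\,(M(B_n),\varphi_{nm})=\Big\{(x_n)\in\prod_n M(B_n) : \varphi_{nm}(x_m)=x_n\text{ for all }n\le m\Big\},$$ that is, a $*$-isomorphism which is a homeomorphism, where the right-hand side has the topology induced by the product of the norm topologies. Moreover the canonical maps $\varphi_n:\Gamma(K(A_0))\to M(B_n)$ are all surjective. -/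

import Mathlib

open Filter Topology
open scoped MultiplierAlgebra

namespace PedersenMultiplier

/-! ### σ-unital C⋆-algebras and canonical approximate identities -/

section ApproximateIdentities

variable {A : Type*} [NonUnitalCStarAlgebra A] [PartialOrder A]

variable (A) in
/-- A C⋆-algebra is σ-unital if it has a countable (i.e. sequential) approximate identity, as
usual consisting of positive contractions. -/
def IsSigmaUnital : Prop :=
  ∃ u : ℕ → A, (∀ n, 0 ≤ u n) ∧ (∀ n, ‖u n‖ ≤ 1) ∧
    (∀ a, Tendsto (fun n => u n * a) atTop (𝓝 a)) ∧
    (∀ a, Tendsto (fun n => a * u n) atTop (𝓝 a))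

/-- A (countable, contractive) canonical approximate identity: an approximate identity `(e n)`
with `0 ≤ e n`, `‖e n‖ ≤ 1` and `e n * e (n + 1) = e n`. -/
structure IsCanonicalApproxIdentity (e : ℕ → A) : Prop where
  nonneg : ∀ n, 0 ≤ e n
  norm_le_one : ∀ n, ‖e n‖ ≤ 1
  mul_succ : ∀ n, e n * e (n + 1) = e n
  tendsto_mul_left : ∀ a, Tendsto (fun n => e n * a) atTop (𝓝 a)
  tendsto_mul_right : ∀ a, Tendsto (fun n => a * e n) atTop (𝓝 a)

end ApproximateIdentities

/-! ### The Pedersen ideal -/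

section PedersenIdeal

variable (A : Type*) [NonUnitalCStarAlgebra A]

/-- A (not necessarily closed) dense two-sided ideal of the algebra `A`. -/
def IsDenseIdeal (J : Submodule ℂ A) : Prop :=
  (∀ a : A, ∀ x ∈ J, a * x ∈ J ∧ x * a ∈ J) ∧ Dense (J : Set A)

/-- The Pedersen ideal `K(A)`: the minimum dense two-sided ideal of `A`, i.e. the intersection of
all dense two-sided ideals. -/
def pedersenIdeal : Submodule ℂ A := sInf {J | IsDenseIdeal A J}

variable {A}

lemma mem_pedersenIdeal {x : A} : x ∈ pedersenIdeal A ↔ ∀ J, IsDenseIdeal A J → x ∈ J := by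
  simp [pedersenIdeal, Submodule.mem_sInf]

lemma mul_mem_left (a : A) {x : A} (hx : x ∈ pedersenIdeal A) : a * x ∈ pedersenIdeal A := by
  rw [mem_pedersenIdeal] at hx ⊢
  exact fun J hJ => (hJ.1 a x (hx J hJ)).1

lemma mul_mem_right (a : A) {x : A} (hx : x ∈ pedersenIdeal A) : x * a ∈ pedersenIdeal A := by
  rw [mem_pedersenIdeal] at hx ⊢
  exact fun J hJ => (hJ.1 a x (hx J hJ)).2

lemma star_mem {x : A} (hx : x ∈ pedersenIdeal A) : star x ∈ pedersenIdeal A := by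
  rw [mem_pedersenIdeal] at hx ⊢
  intro J hJ
  have := hx (J.comap (starLinearEquiv ℂ : A ≃ₗ⋆[ℂ] A).toLinearMap) ⟨?_, ?_⟩
  · simpa using this
  · intro a y hy
    simp only [Submodule.mem_comap, LinearEquiv.coe_coe, starLinearEquiv_apply, star_mul] at hy ⊢
    exact ⟨(hJ.1 _ _ hy).2, (hJ.1 _ _ hy).1⟩
  · exact hJ.2.preimage (starₗᵢ ℂ : A ≃ₗᵢ⋆[ℂ] A).toHomeomorph.isOpenMap

/-- If `x * y = x` for some `y` then `x` lies in the Pedersen ideal. -/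
lemma mem_of_mul_eq {x y : A} (h : x * y = x) : x ∈ pedersenIdeal A := by
  rw [mem_pedersenIdeal]
  intro J hJ
  obtain ⟨z, hz, hzJ⟩ := Metric.dense_iff.1 hJ.2 y 1 one_pos
  rw [Metric.mem_ball, dist_comm, dist_eq_norm] at hz
  have hw : ‖((y - z : A) : Unitization ℂ A)‖ < 1 := by rwa [Unitization.norm_inr]
  let u := Units.oneSub _ hw
  have h1 : (x : Unitization ℂ A) * (u : Unitization ℂ A) = ((x * z : A) : Unitization ℂ A) := by
    rw [Units.val_oneSub, mul_sub, mul_one, ← Unitization.inr_mul, mul_sub, h,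
      ← Unitization.inr_sub, sub_sub_cancel]
  have h2 : (x : Unitization ℂ A) = ((x * z : A) : Unitization ℂ A) * (↑u⁻¹ : Unitization ℂ A) := by
    rw [← h1, Units.mul_inv_cancel_right]
  have h3 : x = (↑u⁻¹ : Unitization ℂ A).fst • (x * z) + (x * z) * (↑u⁻¹ : Unitization ℂ A).snd := by
    simpa using congrArg (fun t => t.snd) h2
  have h4 : x * z ∈ J := (hJ.1 x z hzJ).1
  rw [h3]
  exact J.add_mem (J.smul_mem _ h4) (hJ.1 _ _ h4).2

end PedersenIdeal

section Multipliers

variable (A : Type*) [NonUnitalCStarAlgebra A]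

/-- Pairs `(S, T)` of linear self-maps of the Pedersen ideal `K(A)` with `x * S y = T x * y`,
with pointwise vector space operations and the product `(S, T) (U, V) = (S ∘ U, V ∘ T)`. -/
def multiplierSubalgebra :
    Subalgebra ℂ (Module.End ℂ (pedersenIdeal A) × (Module.End ℂ (pedersenIdeal A))ᵐᵒᵖ) where
  carrier := {p | ∀ x y : pedersenIdeal A, (x : A) * p.1 y = p.2.unop x * y}
  mul_mem' := by
    intro p q hp hq x y
    simp only [Set.mem_ofPred_eq] at hp hq
    simp [hp, hq]
  add_mem' := by
    intro p q hp hq x y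
    simp only [Set.mem_ofPred_eq] at hp hq
    simp [hp, hq, mul_add, add_mul]
  algebraMap_mem' := by
    intro c x y
    simp [Algebra.algebraMap_eq_smul_one, mul_smul_comm, smul_mul_assoc]

/-- `Γ(K(A))`, the algebra of (not necessarily bounded) multipliers (double centralizers) of the
Pedersen ideal of `A`. -/
def PedersenMultipliers : Type _ := ↥(multiplierSubalgebra A)

noncomputable instance : Ring (PedersenMultipliers A) := inferInstanceAs (Ring ↥(multiplierSubalgebra A))
noncomputable instance : Algebra ℂ (PedersenMultipliers A) := inferInstanceAs (Algebra ℂ ↥(multiplierSubalgebra A))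

variable {A}

namespace PedersenMultipliers

/-- The left multiplier `S` of `x = (S, T)`. -/
def left (x : PedersenMultipliers A) : Module.End ℂ (pedersenIdeal A) := x.1.1

/-- The right multiplier `T` of `x = (S, T)`. -/
def right (x : PedersenMultipliers A) : Module.End ℂ (pedersenIdeal A) := x.1.2.unop

lemma central (x : PedersenMultipliers A) (y z : pedersenIdeal A) : (y : A) * x.left z = x.right y * z := x.2 y z

@[ext] lemma ext {x y : PedersenMultipliers A} (h : ∀ z, (x.left z : A) = y.left z)
    (h' : ∀ z, (x.right z : A) = y.right z) : x = y :=
  Subtype.ext (Prod.ext (LinearMap.ext fun z => Subtype.ext (h z))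
    (MulOpposite.unop_injective (LinearMap.ext fun z => Subtype.ext (h' z))))

/-- The element `(S, T)` of `Γ(K(A))`. -/
def mk (S T : Module.End ℂ (pedersenIdeal A))
    (h : ∀ x y : pedersenIdeal A, (x : A) * S y = T x * y) : PedersenMultipliers A := ⟨(S, .op T), h⟩

@[simp] lemma left_mk (S T : Module.End ℂ (pedersenIdeal A)) (h) : (mk S T h).left = S := rfl
@[simp] lemma right_mk (S T : Module.End ℂ (pedersenIdeal A)) (h) : (mk S T h).right = T := rfl
@[simp] lemma left_add (x y : PedersenMultipliers A) : (x + y).left = x.left + y.left := rfl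
@[simp] lemma right_add (x y : PedersenMultipliers A) : (x + y).right = x.right + y.right := rfl
@[simp] lemma left_zero : (0 : PedersenMultipliers A).left = 0 := rfl
@[simp] lemma right_zero : (0 : PedersenMultipliers A).right = 0 := rfl
@[simp] lemma left_one : (1 : PedersenMultipliers A).left = 1 := rfl
@[simp] lemma right_one : (1 : PedersenMultipliers A).right = 1 := rfl
@[simp] lemma left_mul (x y : PedersenMultipliers A) : (x * y).left = x.left * y.left := rfl
@[simp] lemma right_mul (x y : PedersenMultipliers A) : (x * y).right = y.right * x.right := rfl
@[simp] lemma left_smul (c : ℂ) (x : PedersenMultipliers A) : (c • x).left = c • x.left := rfl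
@[simp] lemma right_smul (c : ℂ) (x : PedersenMultipliers A) : (c • x).right = c • x.right := rfl

lemma eq_zero_of_forall_mul {x : pedersenIdeal A} (h : ∀ y : pedersenIdeal A, (y : A) * x = 0) :
    x = 0 := by
  have := h ⟨star (x : A), star_mem x.2⟩
  exact Subtype.ext (CStarRing.star_mul_self_eq_zero_iff _ |>.1 this)

lemma eq_zero_of_forall_mul' {x : pedersenIdeal A} (h : ∀ y : pedersenIdeal A, (x : A) * y = 0) :
    x = 0 := by
  have := h ⟨star (x : A), star_mem x.2⟩
  exact Subtype.ext (CStarRing.mul_star_self_eq_zero_iff _ |>.1 this)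

/-- Linearity of the two maps is automatic: every pair of functions `S, T` from `K(A)` to itself
with `x * S y = T x * y` is an element of `Γ(K(A))`. -/
lemma exists_of_functions (S T : pedersenIdeal A → pedersenIdeal A)
    (h : ∀ x y : pedersenIdeal A, (x : A) * S y = T x * y) :
    ∃ x : PedersenMultipliers A, (∀ y, x.left y = S y) ∧ ∀ y, x.right y = T y := by
  refine ⟨mk ⟨⟨S, ?_⟩, ?_⟩ ⟨⟨T, ?_⟩, ?_⟩ h, fun _ => rfl, fun _ => rfl⟩
  · intro y z
    refine sub_eq_zero.1 (eq_zero_of_forall_mul fun x => ?_)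
    simp [mul_sub, mul_add, h]
  · intro c y
    refine sub_eq_zero.1 (eq_zero_of_forall_mul fun x => ?_)
    simp [mul_sub, h, mul_smul_comm]
  · intro y z
    refine sub_eq_zero.1 (eq_zero_of_forall_mul' fun x => ?_)
    simp [sub_mul, add_mul, ← h]
  · intro c y
    refine sub_eq_zero.1 (eq_zero_of_forall_mul' fun x => ?_)
    simp [sub_mul, ← h, smul_mul_assoc]

/-- For a linear map `S` on `K(A)`, the linear map `x ↦ (S (x⋆))⋆`. -/
def conj (S : Module.End ℂ (pedersenIdeal A)) : Module.End ℂ (pedersenIdeal A) where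
  toFun x := ⟨star (S ⟨star (x : A), star_mem x.2⟩ : A), star_mem (S _).2⟩
  map_add' x y := by
    have : (⟨star ((x + y : pedersenIdeal A) : A), star_mem (x + y).2⟩ : pedersenIdeal A) =
      ⟨star (x : A), star_mem x.2⟩ + ⟨star (y : A), star_mem y.2⟩ := Subtype.ext (by simp)
    refine Subtype.ext ((congrArg (fun t => star (S t : A)) this).trans ?_)
    simp only [map_add, Submodule.coe_add, star_add]
  map_smul' c x := by
    have : (⟨star ((c • x : pedersenIdeal A) : A), star_mem (c • x).2⟩ : pedersenIdeal A) =
      star c • ⟨star (x : A), star_mem x.2⟩ := Subtype.ext (by simp)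
    refine Subtype.ext ((congrArg (fun t => star (S t : A)) this).trans ?_)
    simp only [map_smul, Submodule.coe_smul, star_smul, star_star, RingHom.id_apply]

lemma conj_apply (S : Module.End ℂ (pedersenIdeal A)) (x : pedersenIdeal A) :
    (conj S x : A) = star (S ⟨star (x : A), star_mem x.2⟩ : A) := rfl

/-- The involution: `(S, T)⋆` consists of the maps `x ↦ (T (x⋆))⋆` and `x ↦ (S (x⋆))⋆`. -/
instance : Star (PedersenMultipliers A) where
  star x := mk (conj x.right) (conj x.left) fun y z => by
    have := congrArg star (x.central ⟨star (z : A), star_mem z.2⟩ ⟨star (y : A), star_mem y.2⟩)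
    simpa [conj_apply] using this.symm

lemma left_star (x : PedersenMultipliers A) (z : pedersenIdeal A) :
    ((star x).left z : A) = star (x.right ⟨star (z : A), star_mem z.2⟩ : A) := rfl

lemma right_star (x : PedersenMultipliers A) (z : pedersenIdeal A) :
    ((star x).right z : A) = star (x.left ⟨star (z : A), star_mem z.2⟩ : A) := rfl

instance : StarRing (PedersenMultipliers A) where
  star_involutive x := by ext z <;> simp [left_star, right_star]
  star_mul x y := by ext z <;> simp [left_star, right_star]
  star_add x y := by ext z <;> simp [left_star, right_star]

instance : StarModule ℂ (PedersenMultipliers A) where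
  star_smul c x := by ext z <;> simp [left_star, right_star]

/-- Left multiplication by `a` on `K(A)`. -/
def leftMul (a : A) : Module.End ℂ (pedersenIdeal A) where
  toFun x := ⟨a * x, mul_mem_left a x.2⟩
  map_add' x y := Subtype.ext (mul_add a (x : A) y)
  map_smul' c x := Subtype.ext (mul_smul_comm c a (x : A))

/-- Right multiplication by `a` on `K(A)`. -/
def rightMul (a : A) : Module.End ℂ (pedersenIdeal A) where
  toFun x := ⟨x * a, mul_mem_right a x.2⟩
  map_add' x y := Subtype.ext (add_mul (x : A) y a)
  map_smul' c x := Subtype.ext (smul_mul_assoc c (x : A) a)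

@[simp] lemma leftMul_apply (a : A) (x : pedersenIdeal A) : (leftMul a x : A) = a * x := rfl
@[simp] lemma rightMul_apply (a : A) (x : pedersenIdeal A) : (rightMul a x : A) = x * a := rfl

/-- The embedding of `A` into `Γ(K(A))`, which sends `a` to `(S, T)` with `S x = a * x` and
`T x = x * a`. -/
def ofAlgebra : A →⋆ₙₐ[ℂ] PedersenMultipliers A where
  toFun a := mk (leftMul a) (rightMul a) fun x y => by simp [mul_assoc]
  map_smul' c a := ext (fun z => smul_mul_assoc c a (z : A)) fun z => mul_smul_comm c (z : A) a
  map_zero' := ext (fun z => zero_mul (z : A)) fun z => mul_zero (z : A)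
  map_add' a b := ext (fun z => add_mul a b (z : A)) fun z => mul_add (z : A) a b
  map_mul' a b := ext (fun z => mul_assoc a b (z : A)) fun z => (mul_assoc (z : A) a b).symm
  map_star' a := by
    refine ext (fun z => ?_) fun z => ?_
    · change star a * (z : A) = star (star (z : A) * a)
      simp
    · change (z : A) * star a = star (a * star (z : A))
      simp

@[simp] lemma ofAlgebra_left (a : A) (z : pedersenIdeal A) :
    ((ofAlgebra a).left z : A) = a * z := rfl

@[simp] lemma ofAlgebra_right (a : A) (z : pedersenIdeal A) :
    ((ofAlgebra a).right z : A) = z * a := rfl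

lemma mul_ofAlgebra (x : PedersenMultipliers A) (k : pedersenIdeal A) :
    x * ofAlgebra (k : A) = ofAlgebra (x.left k : A) := by
  refine ext (fun z => ?_) fun z => ?_
  · change (x.left ⟨(k : A) * z, _⟩ : A) = x.left k * z
    refine congrArg Subtype.val (sub_eq_zero.1 (eq_zero_of_forall_mul
      (x := x.left ⟨(k : A) * z, mul_mem_left _ z.2⟩ - ⟨x.left k * z, mul_mem_left _ z.2⟩)
      fun y => ?_))
    rw [Submodule.coe_sub, mul_sub, x.central, ← mul_assoc, ← mul_assoc, x.central, sub_self]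
  · exact (x.central z k).symm

/-- The sets `{b * a | b ∈ A, ‖b * a‖ ≤ 1}`, for positive `a ∈ K(A)`. -/
def topologyFamily (A : Type*) [NonUnitalCStarAlgebra A] [PartialOrder A] :
    Set (Set (pedersenIdeal A)) :=
  {s | ∃ a ∈ pedersenIdeal A, 0 ≤ a ∧
    s = {y : pedersenIdeal A | (∃ b : A, b * a = y) ∧ ‖(y : A)‖ ≤ 1}}

/-- The projective topology of `Γ(K(A))`, defined by the norms
`‖S|_{L_a}‖ = sup {‖S (b * a)‖ | b ∈ A, ‖b * a‖ ≤ 1}` of the restrictions of `(S, T)` to the closed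
left ideals `L_a = closure (A * a)`, for all positive `a ∈ K(A)`: the topology of uniform
convergence of `S` on the sets `{b * a | ‖b * a‖ ≤ 1}`. -/
instance [PartialOrder A] : TopologicalSpace (PedersenMultipliers A) :=
  TopologicalSpace.induced
    (fun x => UniformOnFun.ofFun (topologyFamily A) fun y => (x.left y : A)) inferInstance

end PedersenMultipliers

end Multipliers

section Restricted

variable {A : Type*} [NonUnitalCStarAlgebra A]

/-- The closed left ideal `L_a`, the closure of `A * a`. -/
def leftIdeal (a : A) : Submodule ℂ A := (LinearMap.range (LinearMap.mulRight ℂ a)).topologicalClosure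

/-- The closed right ideal `R_a`, the closure of `a * A`. -/
def rightIdeal (a : A) : Submodule ℂ A := (LinearMap.range (LinearMap.mulLeft ℂ a)).topologicalClosure

lemma isClosed_leftIdeal (a : A) : IsClosed (leftIdeal a : Set A) :=
  Submodule.isClosed_topologicalClosure _

lemma isClosed_rightIdeal (a : A) : IsClosed (rightIdeal a : Set A) :=
  Submodule.isClosed_topologicalClosure _

instance (a : A) : CompleteSpace (leftIdeal a) := (isClosed_leftIdeal a).completeSpace_coe
instance (a : A) : CompleteSpace (rightIdeal a) := (isClosed_rightIdeal a).completeSpace_coe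

lemma mul_mem_leftIdeal (b a : A) : b * a ∈ leftIdeal a :=
  Submodule.le_topologicalClosure _ ⟨b, rfl⟩

lemma mul_mem_rightIdeal (a b : A) : a * b ∈ rightIdeal a :=
  Submodule.le_topologicalClosure _ ⟨b, rfl⟩

/-- A closed condition which holds on `A * a` holds on `L_a`. -/
lemma leftIdeal_induction {a : A} {P : A → Prop} (hP : IsClosed {z | P z}) (h : ∀ b, P (b * a))
    {z : A} (hz : z ∈ leftIdeal a) : P z := by
  have : closure (LinearMap.range (LinearMap.mulRight ℂ a) : Set A) ⊆ {z | P z} :=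
    closure_minimal (by rintro _ ⟨b, rfl⟩; exact h b) hP
  exact this hz

lemma rightIdeal_induction {a : A} {P : A → Prop} (hP : IsClosed {z | P z}) (h : ∀ b, P (a * b))
    {z : A} (hz : z ∈ rightIdeal a) : P z := by
  have : closure (LinearMap.range (LinearMap.mulLeft ℂ a) : Set A) ⊆ {z | P z} :=
    closure_minimal (by rintro _ ⟨b, rfl⟩; exact h b) hP
  exact this hz

lemma leftIdeal_mul_mem {a : A} (c : A) {z : A} (hz : z ∈ leftIdeal a) : c * z ∈ leftIdeal a :=
  leftIdeal_induction (P := fun z => c * z ∈ leftIdeal a)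
    ((isClosed_leftIdeal a).preimage (continuous_const_mul c))
    (fun b => by rw [← mul_assoc]; exact mul_mem_leftIdeal _ _) hz

lemma rightIdeal_mul_mem {a : A} (c : A) {z : A} (hz : z ∈ rightIdeal a) : z * c ∈ rightIdeal a :=
  rightIdeal_induction (P := fun z => z * c ∈ rightIdeal a)
    ((isClosed_rightIdeal a).preimage (continuous_mul_const c))
    (fun b => by rw [mul_assoc]; exact mul_mem_rightIdeal _ _) hz

lemma star_mem_rightIdeal {a z : A} (hz : z ∈ leftIdeal a) : star z ∈ rightIdeal (star a) :=
  leftIdeal_induction (P := fun z => star z ∈ rightIdeal (star a))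
    ((isClosed_rightIdeal _).preimage continuous_star)
    (fun b => by rw [star_mul]; exact mul_mem_rightIdeal _ _) hz

lemma star_mem_leftIdeal {a y : A} (hy : y ∈ rightIdeal (star a)) : star y ∈ leftIdeal a :=
  rightIdeal_induction (P := fun y => star y ∈ leftIdeal a)
    ((isClosed_leftIdeal _).preimage continuous_star)
    (fun b => by rw [star_mul, star_star]; exact mul_mem_leftIdeal _ _) hy

lemma leftIdeal_eq_zero {a : A} {x : A} (hx : x ∈ leftIdeal a)
    (h : ∀ y ∈ rightIdeal (star a), y * x = 0) : x = 0 :=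
  CStarRing.star_mul_self_eq_zero_iff _ |>.1 (h _ (star_mem_rightIdeal hx))

lemma rightIdeal_eq_zero {a : A} {y : A} (hy : y ∈ rightIdeal (star a))
    (h : ∀ x ∈ leftIdeal a, y * x = 0) : y = 0 :=
  CStarRing.mul_star_self_eq_zero_iff _ |>.1 (h _ (star_mem_leftIdeal hy))

/-- Linear maps `S : L_a → L_a` and `T : R_{a⋆} → R_{a⋆}` with `y * S x = T y * x` are
automatically bounded. -/
lemma continuous_of_central {a : A} (S : leftIdeal a →ₗ[ℂ] leftIdeal a)
    (T : rightIdeal (star a) →ₗ[ℂ] rightIdeal (star a))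
    (h : ∀ (x : leftIdeal a) (y : rightIdeal (star a)), (y : A) * S x = T y * x) :
    Continuous S ∧ Continuous T := by
  constructor
  · refine S.continuous_of_seq_closed_graph fun u x w hu hw => ?_
    refine sub_eq_zero.1 (Subtype.ext (leftIdeal_eq_zero (w - S x).2 fun y hy => ?_))
    have h1 : Tendsto (fun n => y * (S (u n) : A)) atTop (𝓝 (y * w)) :=
      ((continuous_subtype_val.tendsto w).comp hw).const_mul y
    have h2 : Tendsto (fun n => y * (S (u n) : A)) atTop (𝓝 (T ⟨y, hy⟩ * x)) :=
      (((continuous_subtype_val.tendsto x).comp hu).const_mul (T ⟨y, hy⟩ : A)).congr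
        fun n => (h (u n) ⟨y, hy⟩).symm
    rw [Submodule.coe_sub, mul_sub, tendsto_nhds_unique h1 h2, h x ⟨y, hy⟩, sub_self]
  · refine T.continuous_of_seq_closed_graph fun u y w hu hw => ?_
    refine sub_eq_zero.1 (Subtype.ext (rightIdeal_eq_zero (w - T y).2 fun x hx => ?_))
    have h1 : Tendsto (fun n => (T (u n) : A) * x) atTop (𝓝 (w * x)) :=
      ((continuous_subtype_val.tendsto w).comp hw).mul_const x
    have h2 : Tendsto (fun n => (T (u n) : A) * x) atTop (𝓝 (y * S ⟨x, hx⟩)) :=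
      (((continuous_subtype_val.tendsto y).comp hu).mul_const (S ⟨x, hx⟩ : A)).congr
        fun n => h ⟨x, hx⟩ (u n)
    rw [Submodule.coe_sub, sub_mul, tendsto_nhds_unique h1 h2, ← h ⟨x, hx⟩ y, sub_self]

/-- The pairs `(S, T)` of bounded linear maps `S : L_a → L_a`, `T : R_{a⋆} → R_{a⋆}` with
`y * S x = T y * x`, with the product `(S, T) (U, V) = (S ∘ U, V ∘ T)` and the norm
`max ‖S‖ ‖T‖`. -/
def restrictedSubalgebra (a : A) :
    Subalgebra ℂ ((leftIdeal a →L[ℂ] leftIdeal a) ×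
      (rightIdeal (star a) →L[ℂ] rightIdeal (star a))ᵐᵒᵖ) where
  carrier := {p | ∀ (x : leftIdeal a) (y : rightIdeal (star a)),
    (y : A) * p.1 x = p.2.unop y * x}
  mul_mem' := by
    intro p q hp hq x y
    simp only [Set.mem_ofPred_eq] at hp hq
    simp [hp, hq]
  add_mem' := by
    intro p q hp hq x y
    simp only [Set.mem_ofPred_eq] at hp hq
    simp [hp, hq, mul_add, add_mul]
  algebraMap_mem' := by
    intro c x y
    simp [Algebra.algebraMap_eq_smul_one, mul_smul_comm, smul_mul_assoc]

/-- The C⋆-algebra `M_a` of all pairs `(S, T)` of linear maps `S : L_a → L_a` and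
`T : R_{a⋆} → R_{a⋆}` such that `y * S x = T y * x` for all `x ∈ L_a` and `y ∈ R_{a⋆}`. -/
def RestrictedMultipliers (a : A) : Type _ := ↥(restrictedSubalgebra a)

namespace RestrictedMultipliers

variable {a : A}

noncomputable instance : NormedRing (RestrictedMultipliers a) :=
  inferInstanceAs (NormedRing ↥(restrictedSubalgebra a))
noncomputable instance : NormedAlgebra ℂ (RestrictedMultipliers a) :=
  inferInstanceAs (NormedAlgebra ℂ ↥(restrictedSubalgebra a))

/-- The map `S` of `x = (S, T)`. -/
def left (x : RestrictedMultipliers a) : leftIdeal a →L[ℂ] leftIdeal a := x.1.1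

/-- The map `T` of `x = (S, T)`. -/
def right (x : RestrictedMultipliers a) : rightIdeal (star a) →L[ℂ] rightIdeal (star a) :=
  x.1.2.unop

lemma central (x : RestrictedMultipliers a) (z : leftIdeal a) (y : rightIdeal (star a)) :
    (y : A) * x.left z = x.right y * z := x.2 z y

@[ext] lemma ext {x y : RestrictedMultipliers a} (h : ∀ z, (x.left z : A) = y.left z)
    (h' : ∀ z, (x.right z : A) = y.right z) : x = y :=
  Subtype.ext (Prod.ext (ContinuousLinearMap.ext fun z => Subtype.ext (h z))
    (MulOpposite.unop_injective (ContinuousLinearMap.ext fun z => Subtype.ext (h' z))))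

/-- The element `(S, T)` of `M_a`. -/
def mk (S : leftIdeal a →L[ℂ] leftIdeal a)
    (T : rightIdeal (star a) →L[ℂ] rightIdeal (star a))
    (h : ∀ (x : leftIdeal a) (y : rightIdeal (star a)), (y : A) * S x = T y * x) :
    RestrictedMultipliers a := ⟨(S, .op T), h⟩

@[simp] lemma left_add (x y : RestrictedMultipliers a) : (x + y).left = x.left + y.left := rfl
@[simp] lemma right_add (x y : RestrictedMultipliers a) : (x + y).right = x.right + y.right := rfl
@[simp] lemma left_zero : (0 : RestrictedMultipliers a).left = 0 := rfl
@[simp] lemma right_zero : (0 : RestrictedMultipliers a).right = 0 := rfl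
@[simp] lemma left_one : (1 : RestrictedMultipliers a).left = 1 := rfl
@[simp] lemma right_one : (1 : RestrictedMultipliers a).right = 1 := rfl
@[simp] lemma left_mul (x y : RestrictedMultipliers a) : (x * y).left = x.left * y.left := rfl
@[simp] lemma right_mul (x y : RestrictedMultipliers a) : (x * y).right = y.right * x.right := rfl
@[simp] lemma left_smul (c : ℂ) (x : RestrictedMultipliers a) : (c • x).left = c • x.left := rfl
@[simp] lemma right_smul (c : ℂ) (x : RestrictedMultipliers a) : (c • x).right = c • x.right := rfl

lemma norm_eq_max (x : RestrictedMultipliers a) : ‖x‖ = max ‖x.left‖ ‖x.right‖ := rfl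

variable (a) in
/-- The conjugate-linear isometry `x ↦ x⋆` from `L_a` to `R_{a⋆}`. -/
noncomputable def starLR : leftIdeal a →L⋆[ℂ] rightIdeal (star a) :=
  LinearMap.mkContinuous
    { toFun := fun x => ⟨star (x : A), star_mem_rightIdeal x.2⟩
      map_add' := fun x y => Subtype.ext (star_add (x : A) y)
      map_smul' := fun c x => Subtype.ext (star_smul c (x : A)) } 1
    fun x => by rw [one_mul]; exact (norm_star (x : A)).le

variable (a) in
/-- The conjugate-linear isometry `y ↦ y⋆` from `R_{a⋆}` to `L_a`. -/
noncomputable def starRL : rightIdeal (star a) →L⋆[ℂ] leftIdeal a :=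
  LinearMap.mkContinuous
    { toFun := fun y => ⟨star (y : A), star_mem_leftIdeal y.2⟩
      map_add' := fun x y => Subtype.ext (star_add (x : A) y)
      map_smul' := fun c x => Subtype.ext (star_smul c (x : A)) } 1
    fun x => by rw [one_mul]; exact (norm_star (x : A)).le

@[simp] lemma starLR_apply (x : leftIdeal a) : (starLR a x : A) = star (x : A) := rfl
@[simp] lemma starRL_apply (y : rightIdeal (star a)) : (starRL a y : A) = star (y : A) := rfl
@[simp] lemma starRL_starLR (x : leftIdeal a) : starRL a (starLR a x) = x :=
  Subtype.ext (star_star (x : A))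
@[simp] lemma starLR_starRL (y : rightIdeal (star a)) : starLR a (starRL a y) = y :=
  Subtype.ext (star_star (y : A))

/-- The involution: `(S, T)⋆` consists of the maps `x ↦ (T (x⋆))⋆` and `y ↦ (S (y⋆))⋆`. -/
noncomputable instance : Star (RestrictedMultipliers a) where
  star x := mk (((starRL a).comp x.right).comp (starLR a)) (((starLR a).comp x.left).comp (starRL a))
    fun z y => by
      have := congrArg star (x.central (starRL a y) (starLR a z))
      simpa using this.symm

@[simp] lemma left_star (x : RestrictedMultipliers a) (z : leftIdeal a) :
    (star x).left z = starRL a (x.right (starLR a z)) := rfl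

@[simp] lemma right_star (x : RestrictedMultipliers a) (y : rightIdeal (star a)) :
    (star x).right y = starLR a (x.left (starRL a y)) := rfl

noncomputable instance : StarRing (RestrictedMultipliers a) where
  star_involutive x := by ext z <;> simp
  star_mul x y := by ext z <;> simp
  star_add x y := by ext z <;> simp

instance : StarModule ℂ (RestrictedMultipliers a) where
  star_smul c x := by ext z <;> simp

lemma le_sqrt_mul {u c v : ℝ} (hc : 0 ≤ c) (hv : 0 ≤ v) (h : u * u ≤ c * (v * v)) :
    u ≤ √c * v := by
  have h1 := Real.le_sqrt_of_sq_le (show u ^ 2 ≤ c * (v * v) by rw [sq]; exact h)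
  rwa [Real.sqrt_mul hc, Real.sqrt_mul_self hv] at h1

lemma norm_left_sq_le (x : RestrictedMultipliers a) : ‖x.left‖ * ‖x.left‖ ≤ ‖(star x * x).left‖ := by
  have key : ∀ z, ‖x.left z‖ ≤ √‖(star x * x).left‖ * ‖z‖ := by
    intro z
    have h1 : ‖x.left z‖ * ‖x.left z‖ ≤ ‖(star x * x).left‖ * (‖z‖ * ‖z‖) := by
      have h2 : star (x.left z : A) * x.left z = star (((star x * x).left z : leftIdeal a) : A) * z := by
        have := x.central z (starLR a (x.left z))
        simpa using this
      calc ‖x.left z‖ * ‖x.left z‖ = ‖star (x.left z : A) * x.left z‖ :=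
            (CStarRing.norm_star_mul_self (x := (x.left z : A))).symm
        _ = ‖star (((star x * x).left z : leftIdeal a) : A) * z‖ := by rw [h2]
        _ ≤ ‖(star x * x).left z‖ * ‖z‖ := (norm_mul_le _ _).trans (by rw [norm_star]; rfl)
        _ ≤ ‖(star x * x).left‖ * ‖z‖ * ‖z‖ := by
            gcongr; exact (star x * x).left.le_opNorm z
        _ = _ := by ring
    exact le_sqrt_mul (ContinuousLinearMap.opNorm_nonneg _) (norm_nonneg _) h1
  have := x.left.opNorm_le_bound (Real.sqrt_nonneg _) key
  calc _ ≤ √‖(star x * x).left‖ * √‖(star x * x).left‖ := by gcongr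
    _ = _ := Real.mul_self_sqrt (ContinuousLinearMap.opNorm_nonneg _)

lemma norm_right_sq_le (x : RestrictedMultipliers a) :
    ‖x.right‖ * ‖x.right‖ ≤ ‖(x * star x).right‖ := by
  have key : ∀ z, ‖x.right z‖ ≤ √‖(x * star x).right‖ * ‖z‖ := by
    intro z
    have h1 : ‖x.right z‖ * ‖x.right z‖ ≤ ‖(x * star x).right‖ * (‖z‖ * ‖z‖) := by
      have h2 : (x.right z : A) * star (x.right z : A) =
          z * star (((x * star x).right z : rightIdeal (star a)) : A) := by
        have := x.central (starRL a (x.right z)) z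
        simpa using this.symm
      calc ‖x.right z‖ * ‖x.right z‖ = ‖(x.right z : A) * star (x.right z : A)‖ :=
            (CStarRing.norm_self_mul_star (x := (x.right z : A))).symm
        _ = ‖(z : A) * star (((x * star x).right z : rightIdeal (star a)) : A)‖ := by rw [h2]
        _ ≤ ‖z‖ * ‖(x * star x).right z‖ := (norm_mul_le _ _).trans (by rw [norm_star]; rfl)
        _ ≤ ‖z‖ * (‖(x * star x).right‖ * ‖z‖) := by
            gcongr; exact (x * star x).right.le_opNorm z
        _ = _ := by ring
    exact le_sqrt_mul (ContinuousLinearMap.opNorm_nonneg _) (norm_nonneg _) h1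
  have := x.right.opNorm_le_bound (Real.sqrt_nonneg _) key
  calc _ ≤ √‖(x * star x).right‖ * √‖(x * star x).right‖ := by gcongr
    _ = _ := Real.mul_self_sqrt (ContinuousLinearMap.opNorm_nonneg _)

lemma norm_right_eq_norm_left_star (x : RestrictedMultipliers a) : ‖(star x).left‖ = ‖x.right‖ := by
  have aux : ∀ x : RestrictedMultipliers a, ‖(star x).left‖ ≤ ‖x.right‖ := fun x =>
    ContinuousLinearMap.opNorm_le_bound _ (ContinuousLinearMap.opNorm_nonneg _) fun z => by
      have h1 : ‖(star x).left z‖ = ‖x.right (starLR a z)‖ := norm_star (x.right (starLR a z) : A)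
      have h2 : ‖starLR a z‖ = ‖z‖ := norm_star (z : A)
      rw [h1, ← h2]
      exact x.right.le_opNorm _
  refine (aux x).antisymm (ContinuousLinearMap.opNorm_le_bound _ (ContinuousLinearMap.opNorm_nonneg _) fun y => ?_)
  have h1 : ‖(star x).left (starRL a y)‖ = ‖x.right y‖ := by
    rw [left_star, starLR_starRL]; exact norm_star (x.right y : A)
  have h2 : ‖starRL a y‖ = ‖y‖ := norm_star (y : A)
  rw [← h1, ← h2]
  exact (star x).left.le_opNorm _

/-- `‖(S, T)‖ = ‖S‖ = ‖T‖`. -/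
lemma norm_left_eq_norm_right (x : RestrictedMultipliers a) : ‖x.left‖ = ‖x.right‖ := by
  have aux : ∀ x : RestrictedMultipliers a, ‖x.left‖ ≤ ‖x.right‖ := fun x => by
    by_contra! h
    have h1 := norm_left_sq_le x
    have h2 : ‖(star x * x).left‖ ≤ ‖x.right‖ * ‖x.left‖ := by
      rw [← norm_right_eq_norm_left_star]; exact ContinuousLinearMap.opNorm_comp_le (star x).left x.left
    nlinarith [ContinuousLinearMap.opNorm_nonneg x.right]
  refine (aux x).antisymm ?_
  have := aux (star x)
  rwa [norm_right_eq_norm_left_star, ← norm_right_eq_norm_left_star (star x), star_star] at this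

lemma norm_eq_norm_left (x : RestrictedMultipliers a) : ‖x‖ = ‖x.left‖ := by
  rw [norm_eq_max, norm_left_eq_norm_right, max_self]

lemma isClosed_restrictedSubalgebra : IsClosed (restrictedSubalgebra a : Set
    ((leftIdeal a →L[ℂ] leftIdeal a) × (rightIdeal (star a) →L[ℂ] rightIdeal (star a))ᵐᵒᵖ)) := by
  have : (restrictedSubalgebra a : Set ((leftIdeal a →L[ℂ] leftIdeal a) ×
      (rightIdeal (star a) →L[ℂ] rightIdeal (star a))ᵐᵒᵖ)) =
      ⋂ (x : leftIdeal a) (y : rightIdeal (star a)),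
        {p | (y : A) * p.1 x = p.2.unop y * x} := by
    ext p; simp [restrictedSubalgebra]
  rw [this]
  refine isClosed_iInter fun x => isClosed_iInter fun y => isClosed_eq ?_ ?_
  · exact continuous_const.mul (continuous_subtype_val.comp
      ((ContinuousLinearMap.apply ℂ _ x).continuous.comp continuous_fst))
  · exact (continuous_subtype_val.comp ((ContinuousLinearMap.apply ℂ _ y).continuous.comp
      (MulOpposite.continuous_unop.comp continuous_snd))).mul continuous_const

instance : CompleteSpace (RestrictedMultipliers a) :=
  (isClosed_restrictedSubalgebra (a := a)).completeSpace_coe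

/-- `M_a` is a (unital) C⋆-algebra. -/
noncomputable instance : CStarAlgebra (RestrictedMultipliers a) where
  norm_mul_self_le x := by
    rw [norm_eq_norm_left, norm_eq_norm_left]
    exact norm_left_sq_le x

end RestrictedMultipliers

end Restricted

/-! ### Surjective homomorphisms of C⋆-algebras and their extension to the multiplier algebras -/

section Surjections

variable {B C : Type*} [NonUnitalCStarAlgebra B] [NonUnitalCStarAlgebra C]

lemma doubleCentralizer_ext {x y : 𝓜(ℂ, B)} (h : ∀ b, x.fst b = y.fst b)
    (h' : ∀ b, x.snd b = y.snd b) : x = y :=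
  DoubleCentralizer.ext _ _ _ _ (Prod.ext (ContinuousLinearMap.ext h) (ContinuousLinearMap.ext h'))

lemma exists_lift_selfAdjoint (f : B →⋆ₙₐ[ℂ] C) {a : B} (ha : IsSelfAdjoint a) :
    ∃ a', f a' = f a ∧ ‖a'‖ ≤ ‖f a‖ := by
  set r := ‖f a‖
  have hr : 0 ≤ r := norm_nonneg _
  have hfa : IsSelfAdjoint (f a) := ha.map f
  refine ⟨cfcₙ (fun t : ℝ => max (-r) (min r t)) a, ?_, ?_⟩
  · rw [NonUnitalStarAlgHom.map_cfcₙ (R := ℝ) (S := ℂ) f (fun t : ℝ => max (-r) (min r t)) a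
      (by fun_prop) (by simp [hr])
      (AddMonoidHomClass.continuous_of_bound f 1 fun b => by
        rw [one_mul]; exact NonUnitalStarAlgHom.norm_apply_le f b) ha hfa]
    conv_rhs => rw [← cfcₙ_id' ℝ (f a)]
    refine cfcₙ_congr fun t ht => ?_
    have h1 : |t| ≤ r := by
      have := norm_apply_le_norm_cfcₙ (fun t : ℝ => t) (f a) ht
      rwa [cfcₙ_id' ℝ (f a)] at this
    rw [abs_le] at h1
    simp [h1.1, h1.2]
  · refine norm_cfcₙ_le fun t _ => ?_
    rw [Real.norm_eq_abs, abs_le]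
    exact ⟨le_max_left _ _, max_le (by linarith) (min_le_left _ _)⟩

open scoped ComplexStarModule in
lemma exists_lift (f : B →⋆ₙₐ[ℂ] C) (a : B) : ∃ a', f a' = f a ∧ ‖a'‖ ≤ 2 * ‖f a‖ := by
  obtain ⟨x, hx, hxn⟩ := exists_lift_selfAdjoint f (ℜ a).2
  obtain ⟨y, hy, hyn⟩ := exists_lift_selfAdjoint f (ℑ a).2
  have hs : ∀ (r : ℝ) (b : B), f (r • b) = r • f b := fun r b => by
    rw [← Complex.coe_smul, map_smul, Complex.coe_smul]
  have h1 : f (ℜ a : B) = (ℜ (f a) : C) := by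
    simp [realPart_apply_coe, hs, map_star f a]
  have h2 : f (ℑ a : B) = (ℑ (f a) : C) := by
    simp [imaginaryPart_apply_coe, hs, map_star f a]
  refine ⟨x + Complex.I • y, ?_, ?_⟩
  · rw [map_add, map_smul, hx, hy, h1, h2, realPart_add_I_smul_imaginaryPart]
  · have h3 : ‖f (ℜ a : B)‖ ≤ ‖f a‖ := by rw [h1]; exact realPart.norm_le (f a)
    have h4 : ‖f (ℑ a : B)‖ ≤ ‖f a‖ := by rw [h2]; exact imaginaryPart.norm_le (f a)
    calc ‖x + Complex.I • y‖ ≤ ‖x‖ + ‖Complex.I • y‖ := norm_add_le _ _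
      _ = ‖x‖ + ‖y‖ := by rw [norm_smul, Complex.norm_I, one_mul]
      _ ≤ 2 * ‖f a‖ := by linarith

/-- The range of a homomorphism of C⋆-algebras is closed. -/
lemma isClosed_range_hom (f : B →⋆ₙₐ[ℂ] C) :
    IsClosed (NonUnitalStarAlgHom.range f : Set C) := by
  let g : NormedAddGroupHom B C :=
    { toFun := f
      map_add' := map_add f
      bound' := ⟨1, fun v => by rw [one_mul]; exact NonUnitalStarAlgHom.norm_apply_le f v⟩ }
  have h1 : g.SurjectiveOnWith g.range 2 := by
    rintro _ ⟨a, rfl⟩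
    exact exists_lift f a
  have h2 := controlled_closure_of_complete two_pos one_pos h1
  refine isClosed_of_closure_subset fun c hc => ?_
  obtain ⟨b, hb, -⟩ := h2 c hc
  exact ⟨b, hb⟩

namespace ExtendMultiplier

variable (ρ : B →⋆ₙₐ[ℂ] C) (hρ : Function.Surjective ρ)

lemma fst_congr (x : 𝓜(ℂ, B)) {b b' : B} (h : ρ b = ρ b') : ρ (x.fst b) = ρ (x.fst b') := by
  rw [← sub_eq_zero, ← CStarRing.star_mul_self_eq_zero_iff, ← map_sub, ← map_sub, ← map_star,
    ← map_mul, ← x.central, map_mul, map_sub ρ b b', h, sub_self, mul_zero]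

lemma snd_congr (x : 𝓜(ℂ, B)) {b b' : B} (h : ρ b = ρ b') : ρ (x.snd b) = ρ (x.snd b') := by
  rw [← sub_eq_zero, ← CStarRing.mul_star_self_eq_zero_iff, ← map_sub, ← map_sub, ← map_star,
    ← map_mul, x.central, map_mul, map_sub ρ b b', h, sub_self, zero_mul]

/-- For a bounded linear `S : B → B` which is compatible with `ρ`, the induced map on `C`. -/
noncomputable def descend (S : B →L[ℂ] B) (hS : ∀ b b', ρ b = ρ b' → ρ (S b) = ρ (S b')) :
    C →L[ℂ] C :=
  LinearMap.mkContinuous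
    { toFun := fun c => ρ (S (Function.surjInv hρ c))
      map_add' := fun c d => by
        rw [← map_add, ← map_add]
        exact hS _ _ (by simp [Function.surjInv_eq hρ])
      map_smul' := fun z c => by
        rw [RingHom.id_apply, ← map_smul, ← map_smul]
        exact hS _ _ (by simp [Function.surjInv_eq hρ]) } (‖S‖ * 2)
    fun c => by
      obtain ⟨b, hb, hbn⟩ := exists_lift ρ (Function.surjInv hρ c)
      rw [Function.surjInv_eq hρ] at hb hbn
      calc ‖ρ (S (Function.surjInv hρ c))‖ = ‖ρ (S b)‖ := by
            rw [hS _ b (by rw [hb, Function.surjInv_eq hρ])]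
        _ ≤ ‖S b‖ := NonUnitalStarAlgHom.norm_apply_le ρ _
        _ ≤ ‖S‖ * ‖b‖ := S.le_opNorm b
        _ ≤ ‖S‖ * (2 * ‖c‖) := by gcongr
        _ = _ := by ring

lemma descend_apply (S : B →L[ℂ] B) (hS : ∀ b b', ρ b = ρ b' → ρ (S b) = ρ (S b')) (b : B) :
    descend ρ hρ S hS (ρ b) = ρ (S b) :=
  hS _ _ (Function.surjInv_eq hρ _)

end ExtendMultiplier

open ExtendMultiplier in
/-- The extension `M(B) → M(C)` of a surjective homomorphism `ρ : B → C` of C⋆-algebras: the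
image of `(S, T)` consists of the maps `ρ b ↦ ρ (S b)` and `ρ b ↦ ρ (T b)`. -/
noncomputable def extendMultiplier (ρ : B →⋆ₙₐ[ℂ] C) (hρ : Function.Surjective ρ) :
    𝓜(ℂ, B) →⋆ₐ[ℂ] 𝓜(ℂ, C) where
  toFun x :=
    { fst := descend ρ hρ x.fst fun _ _ => fst_congr ρ x
      snd := descend ρ hρ x.snd fun _ _ => snd_congr ρ x
      central := fun c d => by
        obtain ⟨b, rfl⟩ := hρ c
        obtain ⟨b', rfl⟩ := hρ d
        rw [descend_apply, descend_apply, ← map_mul, ← map_mul, x.central] }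
  map_one' := by
    ext c <;> obtain ⟨b, rfl⟩ := hρ c <;> simp [descend_apply]
  map_mul' x y := by
    ext c <;> obtain ⟨b, rfl⟩ := hρ c <;> simp [descend_apply]
  map_zero' := by
    ext c <;> obtain ⟨b, rfl⟩ := hρ c <;> simp [descend_apply]
  map_add' x y := by
    ext c <;> obtain ⟨b, rfl⟩ := hρ c <;> simp [descend_apply]
  commutes' z := by
    ext c <;> obtain ⟨b, rfl⟩ := hρ c <;> simp [descend_apply, Algebra.algebraMap_eq_smul_one]
  map_star' x := by
    ext c <;> obtain ⟨b, rfl⟩ := hρ c <;> simp [descend_apply, ← map_star]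

lemma extendMultiplier_fst (ρ : B →⋆ₙₐ[ℂ] C) (hρ : Function.Surjective ρ) (x : 𝓜(ℂ, B)) (b : B) :
    (extendMultiplier ρ hρ x).fst (ρ b) = ρ (x.fst b) :=
  ExtendMultiplier.descend_apply ρ hρ x.fst (fun _ _ => ExtendMultiplier.fst_congr ρ x) b

lemma extendMultiplier_snd (ρ : B →⋆ₙₐ[ℂ] C) (hρ : Function.Surjective ρ) (x : 𝓜(ℂ, B)) (b : B) :
    (extendMultiplier ρ hρ x).snd (ρ b) = ρ (x.snd b) :=
  ExtendMultiplier.descend_apply ρ hρ x.snd (fun _ _ => ExtendMultiplier.snd_congr ρ x) b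

/-- `extendMultiplier ρ` extends `ρ`. -/
lemma extendMultiplier_coe (ρ : B →⋆ₙₐ[ℂ] C) (hρ : Function.Surjective ρ) (b : B) :
    extendMultiplier ρ hρ (b : 𝓜(ℂ, B)) = (ρ b : 𝓜(ℂ, C)) := by
  ext c <;> obtain ⟨b', rfl⟩ := hρ c <;> simp [extendMultiplier_fst, extendMultiplier_snd]

/-- An element `m` of a C⋆-algebra with `m * D ⊆ D` and `D * m ⊆ D` for a C⋆-subalgebra `D`, as a
multiplier of `D`. -/
noncomputable def multiplierOfMem {M : Type*} [CStarAlgebra M] (D : NonUnitalStarSubalgebra ℂ M)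
    [IsClosed (D : Set M)] (m : M) (hl : ∀ b ∈ D, m * b ∈ D) (hr : ∀ b ∈ D, b * m ∈ D) :
    𝓜(ℂ, D) where
  fst := LinearMap.mkContinuous
    { toFun := fun b => ⟨m * b, hl b b.2⟩
      map_add' := fun _ _ => Subtype.ext (mul_add _ _ _)
      map_smul' := fun _ _ => Subtype.ext (mul_smul_comm _ _ _) } ‖m‖
    fun b => norm_mul_le m (b : M)
  snd := LinearMap.mkContinuous
    { toFun := fun b => ⟨b * m, hr b b.2⟩
      map_add' := fun _ _ => Subtype.ext (add_mul _ _ _)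
      map_smul' := fun _ _ => Subtype.ext (smul_mul_assoc _ _ _) } ‖m‖
    fun b => (norm_mul_le (b : M) m).trans (mul_comm ‖(b : M)‖ ‖m‖).le
  central _ _ := Subtype.ext (mul_assoc _ _ _)

end Surjections

/-! ### The inverse system `M(B_n)` of a canonical approximate identity -/

section InverseSystem

variable {A : Type*} [NonUnitalCStarAlgebra A] [PartialOrder A] {e : ℕ → A}

namespace IsCanonicalApproxIdentity

lemma mul_eq_of_lt (he : IsCanonicalApproxIdentity e) {n m : ℕ} (h : n < m) :
    e n * e m = e n := by
  induction m, h using Nat.le_induction with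
  | base => exact he.mul_succ n
  | succ m _ ih => rw [← ih, mul_assoc, he.mul_succ]

lemma mem_pedersenIdeal (he : IsCanonicalApproxIdentity e) (n : ℕ) : e n ∈ pedersenIdeal A :=
  mem_of_mul_eq (he.mul_succ n)

lemma leftIdeal_mul (he : IsCanonicalApproxIdentity e) {n m : ℕ} (h : n < m) {z : A}
    (hz : z ∈ leftIdeal (e n)) : z * e m = z :=
  leftIdeal_induction (P := fun z => z * e m = z)
    (isClosed_eq (continuous_mul_const _) continuous_id)
    (fun b => by rw [mul_assoc, he.mul_eq_of_lt h]) hz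

lemma leftIdeal_le (he : IsCanonicalApproxIdentity e) (n : ℕ) : leftIdeal (e n) ≤ pedersenIdeal A :=
  fun _ hz => mem_of_mul_eq (he.leftIdeal_mul n.lt_succ_self hz)

lemma rightIdeal_le (he : IsCanonicalApproxIdentity e) (n : ℕ) :
    rightIdeal (star (e n)) ≤ pedersenIdeal A := fun y hy => by
  have := star_mem (he.leftIdeal_le n (star_mem_leftIdeal hy))
  rwa [star_star] at this

lemma left_mem (he : IsCanonicalApproxIdentity e) (n : ℕ) (x : PedersenMultipliers A)
    (z : pedersenIdeal A) (hz : (z : A) ∈ leftIdeal (e n)) : (x.left z : A) ∈ leftIdeal (e n) :=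
  (isClosed_leftIdeal _).mem_of_tendsto (he.tendsto_mul_left (x.left z : A)) <|
    .of_forall fun m => by
      have := x.central ⟨e m, he.mem_pedersenIdeal m⟩ z
      change e m * (x.left z : A) ∈ leftIdeal (e n)
      change e m * (x.left z : A) = _ at this
      rw [this]
      exact leftIdeal_mul_mem _ hz

lemma right_mem (he : IsCanonicalApproxIdentity e) (n : ℕ) (x : PedersenMultipliers A)
    (y : pedersenIdeal A) (hy : (y : A) ∈ rightIdeal (star (e n))) :
    (x.right y : A) ∈ rightIdeal (star (e n)) :=
  (isClosed_rightIdeal _).mem_of_tendsto (he.tendsto_mul_right (x.right y : A)) <|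
    .of_forall fun m => by
      have := x.central y ⟨e m, he.mem_pedersenIdeal m⟩
      change (x.right y : A) * e m ∈ rightIdeal (star (e n))
      change _ = (x.right y : A) * e m at this
      rw [← this]
      exact rightIdeal_mul_mem _ hy

/-- The restriction of `S` to `L_{e n}`, for `x = (S, T)` in `Γ(K(A))`. -/
def restrictLeft (he : IsCanonicalApproxIdentity e) (n : ℕ) (x : PedersenMultipliers A) :
    leftIdeal (e n) →ₗ[ℂ] leftIdeal (e n) where
  toFun z := ⟨x.left ⟨z, he.leftIdeal_le n z.2⟩, he.left_mem n x _ z.2⟩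
  map_add' z w := Subtype.ext (congrArg (fun t : pedersenIdeal A => (t : A))
    (x.left.map_add ⟨z, he.leftIdeal_le n z.2⟩ ⟨w, he.leftIdeal_le n w.2⟩))
  map_smul' c z := Subtype.ext (congrArg (fun t : pedersenIdeal A => (t : A))
    (x.left.map_smul c ⟨z, he.leftIdeal_le n z.2⟩))

/-- The restriction of `T` to `R_{(e n)⋆}`, for `x = (S, T)` in `Γ(K(A))`. -/
def restrictRight (he : IsCanonicalApproxIdentity e) (n : ℕ) (x : PedersenMultipliers A) :
    rightIdeal (star (e n)) →ₗ[ℂ] rightIdeal (star (e n)) where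
  toFun z := ⟨x.right ⟨z, he.rightIdeal_le n z.2⟩, he.right_mem n x _ z.2⟩
  map_add' z w := Subtype.ext (congrArg (fun t : pedersenIdeal A => (t : A))
    (x.right.map_add ⟨z, he.rightIdeal_le n z.2⟩ ⟨w, he.rightIdeal_le n w.2⟩))
  map_smul' c z := Subtype.ext (congrArg (fun t : pedersenIdeal A => (t : A))
    (x.right.map_smul c ⟨z, he.rightIdeal_le n z.2⟩))

lemma continuous_restrict (he : IsCanonicalApproxIdentity e) (n : ℕ) (x : PedersenMultipliers A) :
    Continuous (he.restrictLeft n x) ∧ Continuous (he.restrictRight n x) :=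
  continuous_of_central _ _ fun z y =>
    x.central ⟨y, he.rightIdeal_le n y.2⟩ ⟨z, he.leftIdeal_le n z.2⟩

/-- The restriction map `φ_n : Γ(K(A)) → M_{e n}`, `(S, T) ↦ (S|_{L_{e n}}, T|_{R_{(e n)⋆}})`. -/
def restrict (he : IsCanonicalApproxIdentity e) (n : ℕ) :
    PedersenMultipliers A →⋆ₐ[ℂ] RestrictedMultipliers (e n) where
  toFun x := .mk ⟨he.restrictLeft n x, (he.continuous_restrict n x).1⟩
    ⟨he.restrictRight n x, (he.continuous_restrict n x).2⟩ fun z y =>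
      x.central ⟨y, he.rightIdeal_le n y.2⟩ ⟨z, he.leftIdeal_le n z.2⟩
  map_one' := RestrictedMultipliers.ext (fun _ => rfl) fun _ => rfl
  map_mul' _ _ := RestrictedMultipliers.ext (fun _ => rfl) fun _ => rfl
  map_zero' := RestrictedMultipliers.ext (fun _ => rfl) fun _ => rfl
  map_add' _ _ := RestrictedMultipliers.ext (fun _ => rfl) fun _ => rfl
  commutes' c := by
    rw [Algebra.algebraMap_eq_smul_one, Algebra.algebraMap_eq_smul_one]
    exact RestrictedMultipliers.ext (fun _ => rfl) fun _ => rfl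
  map_star' _ := RestrictedMultipliers.ext (fun _ => rfl) fun _ => rfl

lemma restrict_left (he : IsCanonicalApproxIdentity e) (n : ℕ) (x : PedersenMultipliers A)
    (z : leftIdeal (e n)) :
    ((he.restrict n x).left z : A) = x.left ⟨z, he.leftIdeal_le n z.2⟩ := rfl

lemma restrict_right (he : IsCanonicalApproxIdentity e) (n : ℕ) (x : PedersenMultipliers A)
    (y : rightIdeal (star (e n))) :
    ((he.restrict n x).right y : A) = x.right ⟨y, he.rightIdeal_le n y.2⟩ := rfl

/-- The restriction `φ_n : A → M_{e n}` of `φ_n` to `A ⊆ Γ(K(A))`. -/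
noncomputable def restrictAlgebra (he : IsCanonicalApproxIdentity e) (n : ℕ) :
    A →⋆ₙₐ[ℂ] RestrictedMultipliers (e n) :=
  (he.restrict n : PedersenMultipliers A →⋆ₙₐ[ℂ] RestrictedMultipliers (e n)).comp
    PedersenMultipliers.ofAlgebra

lemma restrictAlgebra_left (he : IsCanonicalApproxIdentity e) (n : ℕ) (a : A)
    (z : leftIdeal (e n)) : ((he.restrictAlgebra n a).left z : A) = a * z := rfl

lemma restrictAlgebra_right (he : IsCanonicalApproxIdentity e) (n : ℕ) (a : A)
    (y : rightIdeal (star (e n))) : ((he.restrictAlgebra n a).right y : A) = y * a := rfl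

/-- The C⋆-subalgebra `B_n = φ_n(A)` of `M_{e n}`. -/
noncomputable def image (he : IsCanonicalApproxIdentity e) (n : ℕ) :
    NonUnitalStarSubalgebra ℂ (RestrictedMultipliers (e n)) :=
  NonUnitalStarAlgHom.range (he.restrictAlgebra n)

instance (he : IsCanonicalApproxIdentity e) (n : ℕ) :
    IsClosed (he.image n : Set (RestrictedMultipliers (e n))) :=
  isClosed_range_hom _

/-- `φ_n`, as a surjection from `A` onto `B_n`. -/
noncomputable def toImage (he : IsCanonicalApproxIdentity e) (n : ℕ) : A →⋆ₙₐ[ℂ] he.image n :=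
  NonUnitalStarAlgHom.codRestrict (he.restrictAlgebra n) (he.image n) fun a => ⟨a, rfl⟩

lemma toImage_surjective (he : IsCanonicalApproxIdentity e) (n : ℕ) :
    Function.Surjective (he.toImage n) := by
  rintro ⟨_, a, rfl⟩
  exact ⟨a, rfl⟩

lemma coe_toImage (he : IsCanonicalApproxIdentity e) (n : ℕ) (a : A) :
    (he.toImage n a : RestrictedMultipliers (e n)) = he.restrictAlgebra n a := rfl

lemma leftIdeal_mono (he : IsCanonicalApproxIdentity e) {n m : ℕ} (h : n ≤ m) :
    leftIdeal (e n) ≤ leftIdeal (e m) := by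
  rcases h.eq_or_lt with rfl | h
  · exact le_rfl
  · intro z hz
    rw [← he.leftIdeal_mul h hz]
    exact mul_mem_leftIdeal _ _

lemma rightIdeal_mono (he : IsCanonicalApproxIdentity e) {n m : ℕ} (h : n ≤ m) :
    rightIdeal (star (e n)) ≤ rightIdeal (star (e m)) := fun y hy => by
  have := star_mem_rightIdeal (he.leftIdeal_mono h (star_mem_leftIdeal hy))
  rwa [star_star] at this

/-- If `φ_m a = φ_m b` then `φ_n a = φ_n b` for `n ≤ m`. -/
lemma toImage_congr (he : IsCanonicalApproxIdentity e) {n m : ℕ} (h : n ≤ m) {a b : A}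
    (hab : he.toImage m a = he.toImage m b) : he.toImage n a = he.toImage n b := by
  have h1 : he.restrictAlgebra m a = he.restrictAlgebra m b := congrArg Subtype.val hab
  refine Subtype.ext (RestrictedMultipliers.ext (fun z => ?_) fun y => ?_)
  · have := congrArg (fun t : RestrictedMultipliers (e m) => (t.left ⟨z, he.leftIdeal_mono h z.2⟩ : A)) h1
    exact this
  · have := congrArg (fun t : RestrictedMultipliers (e m) => (t.right ⟨y, he.rightIdeal_mono h y.2⟩ : A))
      h1
    exact this

/-- The connecting map `φ_{nm} : B_m → B_n` for `n ≤ m`, which restricts the maps of a pair in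
`B_m` from `L_{e m}`, `R_{(e m)⋆}` to `L_{e n}`, `R_{(e n)⋆}`; it sends `φ_m a` to `φ_n a`. -/
noncomputable def connect (he : IsCanonicalApproxIdentity e) {n m : ℕ} (h : n ≤ m) :
    he.image m →⋆ₙₐ[ℂ] he.image n where
  toFun b := he.toImage n (Function.surjInv (he.toImage_surjective m) b)
  map_smul' c b := by
    rw [MonoidHom.id_apply, ← map_smul]
    exact he.toImage_congr h (by simp [Function.surjInv_eq])
  map_zero' := by
    rw [← map_zero (he.toImage n)]
    exact he.toImage_congr h (by simp [Function.surjInv_eq])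
  map_add' b c := by
    rw [← map_add]
    exact he.toImage_congr h (by simp [Function.surjInv_eq])
  map_mul' b c := by
    rw [← map_mul]
    exact he.toImage_congr h (by simp [Function.surjInv_eq])
  map_star' b := by
    rw [← map_star]
    exact he.toImage_congr h (by rw [map_star]; simp [Function.surjInv_eq])

lemma connect_toImage (he : IsCanonicalApproxIdentity e) {n m : ℕ} (h : n ≤ m) (a : A) :
    he.connect h (he.toImage m a) = he.toImage n a :=
  he.toImage_congr h (Function.surjInv_eq _ _)

lemma connect_left (he : IsCanonicalApproxIdentity e) {n m : ℕ} (h : n ≤ m) (b : he.image m)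
    (z : leftIdeal (e n)) : ((he.connect h b : RestrictedMultipliers (e n)).left z : A) =
      (b : RestrictedMultipliers (e m)).left ⟨z, he.leftIdeal_mono h z.2⟩ := by
  obtain ⟨a, rfl⟩ := he.toImage_surjective m b
  rw [connect_toImage]
  rfl

lemma connect_right (he : IsCanonicalApproxIdentity e) {n m : ℕ} (h : n ≤ m) (b : he.image m)
    (y : rightIdeal (star (e n))) : ((he.connect h b : RestrictedMultipliers (e n)).right y : A) =
      (b : RestrictedMultipliers (e m)).right ⟨y, he.rightIdeal_mono h y.2⟩ := by
  obtain ⟨a, rfl⟩ := he.toImage_surjective m b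
  rw [connect_toImage]
  rfl

lemma connect_surjective (he : IsCanonicalApproxIdentity e) {n m : ℕ} (h : n ≤ m) :
    Function.Surjective (he.connect h) := fun b => by
  obtain ⟨a, rfl⟩ := he.toImage_surjective n b
  exact ⟨_, he.connect_toImage h a⟩

/-- The connecting map `φ_{nm} : M(B_m) → M(B_n)` for `n ≤ m`, the extension of
`φ_{nm} : B_m → B_n` to the multiplier algebras. -/
noncomputable def connectMultiplier (he : IsCanonicalApproxIdentity e) {n m : ℕ} (h : n ≤ m) :
    𝓜(ℂ, he.image m) →⋆ₐ[ℂ] 𝓜(ℂ, he.image n) :=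
  extendMultiplier (he.connect h) (he.connect_surjective h)

/-- The inverse limit of the C⋆-algebras `M(B_n)` along the connecting maps `φ_{nm}`, as a
⋆-subalgebra of their product; it carries the subspace topology of the product of the norm
topologies. -/
def inverseLimit (he : IsCanonicalApproxIdentity e) :
    StarSubalgebra ℂ (∀ n, 𝓜(ℂ, he.image n)) where
  carrier := {x | ∀ (n m : ℕ) (h : n ≤ m), he.connectMultiplier h (x m) = x n}
  mul_mem' hx hy n m h := by simp [hx n m h, hy n m h]
  add_mem' hx hy n m h := by simp [hx n m h, hy n m h]
  algebraMap_mem' c n m h := AlgHomClass.commutes (he.connectMultiplier h) c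
  star_mem' hx n m h := by simp [map_star, hx n m h]

lemma restrict_mul_mem (he : IsCanonicalApproxIdentity e) (n : ℕ) (x : PedersenMultipliers A)
    {b : RestrictedMultipliers (e n)} (hb : b ∈ he.image n) : he.restrict n x * b ∈ he.image n := by
  obtain ⟨a, rfl⟩ := hb
  have hc : Continuous (he.restrictAlgebra n) :=
    AddMonoidHomClass.continuous_of_bound (he.restrictAlgebra n) 1 fun b => by
      rw [one_mul]; exact NonUnitalStarAlgHom.norm_apply_le _ b
  have hcl : IsClosed (he.image n : Set (RestrictedMultipliers (e n))) := inferInstance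
  refine hcl.mem_of_tendsto
    (((hc.tendsto a).comp (he.tendsto_mul_left a)).const_mul (he.restrict n x)) <|
    .of_forall fun m => ?_
  refine ⟨x.left ⟨e m * a, mul_mem_right a (he.mem_pedersenIdeal m)⟩, ?_⟩
  exact (congrArg (he.restrict n) (PedersenMultipliers.mul_ofAlgebra x ⟨e m * a, mul_mem_right a
    (he.mem_pedersenIdeal m)⟩)).symm.trans (map_mul (he.restrict n) _ _)

lemma mul_restrict_mem (he : IsCanonicalApproxIdentity e) (n : ℕ) (x : PedersenMultipliers A)
    {b : RestrictedMultipliers (e n)} (hb : b ∈ he.image n) : b * he.restrict n x ∈ he.image n := by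
  have h1 := StarMemClass.star_mem (he.restrict_mul_mem n (star x) (StarMemClass.star_mem hb))
  rwa [star_mul, star_star, map_star, star_star] at h1

/-- The canonical map `φ_n : Γ(K(A)) → M(B_n)`: the multiplier `φ_n x` acts on `B_n ⊆ M_{e n}` by
left and right multiplication with the restriction `φ_n x ∈ M_{e n}`. -/
noncomputable def toMultiplier (he : IsCanonicalApproxIdentity e) (n : ℕ) :
    PedersenMultipliers A →⋆ₐ[ℂ] 𝓜(ℂ, he.image n) where
  toFun x := multiplierOfMem (he.image n) (he.restrict n x)
    (fun _ hb => he.restrict_mul_mem n x hb) fun _ hb => he.mul_restrict_mem n x hb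
  map_one' := doubleCentralizer_ext (fun b => Subtype.ext (by
      change he.restrict n 1 * (b : RestrictedMultipliers (e n)) = b
      rw [map_one, one_mul])) fun b => Subtype.ext (by
      change (b : RestrictedMultipliers (e n)) * he.restrict n 1 = b
      rw [map_one, mul_one])
  map_mul' x y := doubleCentralizer_ext (fun b => Subtype.ext (by
      change he.restrict n (x * y) * (b : RestrictedMultipliers (e n)) =
        he.restrict n x * (he.restrict n y * b)
      rw [map_mul, mul_assoc])) fun b => Subtype.ext (by
      change (b : RestrictedMultipliers (e n)) * he.restrict n (x * y) =
        b * he.restrict n x * he.restrict n y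
      rw [map_mul, mul_assoc])
  map_zero' := doubleCentralizer_ext (fun b => Subtype.ext (by
      change he.restrict n 0 * (b : RestrictedMultipliers (e n)) = 0
      rw [map_zero, zero_mul])) fun b => Subtype.ext (by
      change (b : RestrictedMultipliers (e n)) * he.restrict n 0 = 0
      rw [map_zero, mul_zero])
  map_add' x y := doubleCentralizer_ext (fun b => Subtype.ext (by
      change he.restrict n (x + y) * (b : RestrictedMultipliers (e n)) =
        he.restrict n x * b + he.restrict n y * b
      rw [map_add, add_mul])) fun b => Subtype.ext (by
      change (b : RestrictedMultipliers (e n)) * he.restrict n (x + y) =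
        b * he.restrict n x + b * he.restrict n y
      rw [map_add, mul_add])
  commutes' c := doubleCentralizer_ext (fun b => Subtype.ext (by
      rw [DoubleCentralizer.algebraMap_fst, Algebra.algebraMap_eq_smul_one,
        Algebra.algebraMap_eq_smul_one]
      change he.restrict n (c • 1) * (b : RestrictedMultipliers (e n)) = c • b
      rw [map_smul, map_one, smul_mul_assoc, one_mul])) fun b => Subtype.ext (by
      rw [DoubleCentralizer.algebraMap_snd, Algebra.algebraMap_eq_smul_one,
        Algebra.algebraMap_eq_smul_one]
      change (b : RestrictedMultipliers (e n)) * he.restrict n (c • 1) = c • b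
      rw [map_smul, map_one, mul_smul_comm, mul_one])
  map_star' x := doubleCentralizer_ext (fun b => Subtype.ext (by
      change he.restrict n (star x) * (b : RestrictedMultipliers (e n)) =
        star (star (b : RestrictedMultipliers (e n)) * he.restrict n x)
      rw [map_star, star_mul, star_star])) fun b => Subtype.ext (by
      change (b : RestrictedMultipliers (e n)) * he.restrict n (star x) =
        star (he.restrict n x * star (b : RestrictedMultipliers (e n)))
      rw [map_star, star_mul, star_star])

lemma toMultiplier_fst (he : IsCanonicalApproxIdentity e) (n : ℕ) (x : PedersenMultipliers A)
    (b : he.image n) : (((he.toMultiplier n x).fst b : he.image n) : RestrictedMultipliers (e n)) =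
      he.restrict n x * b := rfl

lemma toMultiplier_snd (he : IsCanonicalApproxIdentity e) (n : ℕ) (x : PedersenMultipliers A)
    (b : he.image n) : (((he.toMultiplier n x).snd b : he.image n) : RestrictedMultipliers (e n)) =
      b * he.restrict n x := rfl

end IsCanonicalApproxIdentity

end InverseSystem

end PedersenMultiplier

/-! Existence. A weighted sum `h` of the squares of a countable approximate identity dominates a
multiple of each of these squares. Applying to `h` ramp functions that reach `1` ever closer to `0`
gives the sequence `e n`.

Injectivity and topology. The kernel of `φ_n : A → B_n` annihilates the algebraic ideal `A e_n A`
from both sides (`twoSidedSpan_le_kernelAnnihilator`), and a homomorphism is isometric on the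
annihilator of its kernel (`norm_map_of_mem_kernelAnnihilator`). By minimality, the Pedersen ideal
is the increasing union of the ideals `A e_n A` (`exists_mem_twoSidedSpan`), so `φ_n` sees each of
its elements isometrically once `n` is large. Multipliers preserve these annihilators, hence `‖S k‖
≤ ‖φ_n x‖ ‖k‖` there (`norm_left_le`). This gives injectivity and the continuity of the inverse.
Conversely `L_{e n} ⊆ A e_{n+1}` bounds `‖φ_n x‖` by a seminorm of the projective topology.

Gluing. Given a compatible family `u`, lift each `u m` to some `y m` in `Γ(K(A))`. On a fixed `k` in
the Pedersen ideal the action of `y m` is eventually constant by the same estimate, and the stable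
values form the required multiplier.

Surjectivity of each `φ_n` is the hard part, a form of the noncommutative Tietze theorem
(`exists_lift_sequence`). Let `E i` be the image of `e i` and `x` a selfadjoint multiplier of `B_n`.
With `D = E (i+3) - E (i+1)` and `D' = E (i+2) - E (i+1)`, the increment `E (i+3) x E (i+3) - E
(i+2) x E (i+2)` is the sum of the block `D x D - D' x D'` and of `(E (i+3) - E (i+2)) x E (i+1)`
plus its adjoint. After passage to a subsequence the second part is summable and lifts with summable
norms. The block is only bounded, but compression by `E (i+4) - E i` does not change it. So its lift
may be compressed by `d = e (i+4) - e i`, and `d² ≤ e (i+4)² - e i²` telescopes, which bounds the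
partial sums. They converge strictly, and their limit is a multiplier of the Pedersen ideal because
`lim s_m (a e_n b) = (lim s_m a) e_n b`. -/

namespace PedersenMultiplier

/-! ### Existence of canonical approximate identities -/

/-- A sequence of contractions which is a left approximate unit on every element of
a left approximate unit `u` is a left approximate unit. -/
lemma tendsto_mul_of_tendsto_mul {A : Type*} [NonUnitalCStarAlgebra A] {e u : ℕ → A} (he : ∀ n, ‖e n‖ ≤ 1)
    (hu : ∀ a, Tendsto (fun n => u n * a) atTop (𝓝 a))
    (h : ∀ k, Tendsto (fun n => e n * u k) atTop (𝓝 (u k))) (a : A) :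
    Tendsto (fun n => e n * a) atTop (𝓝 a) := by
  rw [Metric.tendsto_atTop]
  intro ε hε
  obtain ⟨k, hk⟩ := (Metric.tendsto_atTop.1 (hu a)) (ε / 3) (by positivity)
  have hk := hk k le_rfl
  obtain ⟨N, hN⟩ := (Metric.tendsto_atTop.1 ((h k).mul_const a)) (ε / 3) (by positivity)
  refine ⟨N, fun n hn => ?_⟩
  have hn := hN n hn
  rw [dist_eq_norm] at hk hn ⊢
  have : e n * a - a = (e n * u k * a - u k * a) + (u k * a - a) - e n * (u k * a - a) := by
    noncomm_ring
  rw [this]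
  have h3 : ‖e n * (u k * a - a)‖ ≤ 1 * ‖u k * a - a‖ :=
    (norm_mul_le _ _).trans (by gcongr; exact he n)
  calc _ ≤ ‖e n * u k * a - u k * a‖ + ‖u k * a - a‖ + ‖e n * (u k * a - a)‖ :=
        (norm_sub_le _ _).trans (by gcongr; exact norm_add_le _ _)
    _ < ε := by linarith

/-! ### Order inequalities in C⋆-algebras. -/

section Order

variable {A : Type*} [NonUnitalCStarAlgebra A] [PartialOrder A] [StarOrderedRing A]

/-- Conjugation by the square root gives `e * e = √e * e * √e ≤ ‖e‖ • e`. -/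
lemma mul_self_le_self {e : A} (he : 0 ≤ e) (h1 : ‖e‖ ≤ 1) : e * e ≤ e := by
  have hs : IsSelfAdjoint (CFC.sqrt e) := (CFC.sqrt_nonneg e).isSelfAdjoint
  have hsq : CFC.sqrt e * CFC.sqrt e = e := CFC.sqrt_mul_sqrt_self e he
  have h2 := CStarAlgebra.star_left_conjugate_le_norm_smul (a := CFC.sqrt e) (b := e)
    he.isSelfAdjoint
  rw [hs.star_eq, hsq] at h2
  have h3 : CFC.sqrt e * e * CFC.sqrt e = e * e := by
    nth_rewrite 2 [← hsq]
    rw [← mul_assoc, hsq, mul_assoc, hsq]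
  rw [h3] at h2
  refine h2.trans ?_
  have h4 : 0 ≤ (1 - ‖e‖) • e := smul_nonneg (sub_nonneg.2 h1) he
  rwa [sub_smul, one_smul, sub_nonneg] at h4

/-- `(1 - e) * x * (1 - e) ≥ 0` for `x ≥ 0` and selfadjoint `e`. -/
lemma conjugate_one_sub_nonneg {x e : A} (hx : 0 ≤ x) (he : IsSelfAdjoint e) :
    0 ≤ x - e * x - (x - e * x) * e := by
  obtain ⟨y, rfl⟩ := CStarAlgebra.nonneg_iff_eq_star_mul_self.1 hx
  have : star y * y - e * (star y * y) - (star y * y - e * (star y * y)) * e =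
      star (y - y * e) * (y - y * e) := by
    rw [star_sub, star_mul, he.star_eq]
    noncomm_ring
  rw [this]
  exact star_mul_self_nonneg _

/-- The norm is monotone on positive elements and `0 ≤ s + d ≤ d + d`. The constant `3` is not
sharp; only boundedness matters later. -/
lemma norm_le_of_le_of_neg_le {s d : A} (h1 : s ≤ d) (h2 : -d ≤ s) : ‖s‖ ≤ 3 * ‖d‖ := by
  have h3 : 0 ≤ s + d := by simpa using add_le_add_left h2 d
  have h4 : ‖s + d‖ ≤ ‖d + d‖ :=
    CStarAlgebra.norm_le_norm_of_nonneg_of_le h3 (by gcongr)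
  calc ‖s‖ = ‖s + d - d‖ := by rw [add_sub_cancel_right]
    _ ≤ ‖s + d‖ + ‖d‖ := norm_sub_le _ _
    _ ≤ ‖d‖ + ‖d‖ + ‖d‖ := by gcongr; exact h4.trans (norm_add_le _ _)
    _ = _ := by ring

end Order

section Existence

variable {A : Type*} [NonUnitalCStarAlgebra A] [PartialOrder A] [StarOrderedRing A]

/-- The ramp which vanishes for `t ≤ 2⁻ⁿ⁻¹` and is `1` for `t ≥ 2⁻ⁿ`. -/
noncomputable def ramp (n : ℕ) (t : ℝ) : ℝ := max 0 (min 1 (2 ^ (n + 1) * t - 1))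

lemma continuous_ramp (n : ℕ) : Continuous (ramp n) := by unfold ramp; fun_prop

lemma ramp_zero (n : ℕ) : ramp n 0 = 0 := by simp [ramp]

lemma ramp_nonneg (n : ℕ) (t : ℝ) : 0 ≤ ramp n t := le_max_left _ _

lemma ramp_le_one (n : ℕ) (t : ℝ) : ramp n t ≤ 1 := max_le zero_le_one (min_le_left _ _)

/-- The breakpoints are dyadic for this purpose: `ramp (n + 1)` has already reached `1` at the point
where `ramp n` leaves `0`. -/
lemma ramp_mul_succ (n : ℕ) (t : ℝ) : ramp n t * ramp (n + 1) t = ramp n t := by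
  rcases le_total (2 ^ (n + 1) * t) 1 with h | h
  · have : ramp n t = 0 := max_eq_left ((min_le_right _ _).trans (by linarith))
    rw [this, zero_mul]
  · have : ramp (n + 1) t = 1 := by
      have h1 : (1 : ℝ) ≤ 2 ^ (n + 1 + 1) * t - 1 := by rw [pow_succ]; linarith
      rw [ramp, min_eq_left h1, max_eq_right zero_le_one]
    rw [this, mul_one]

/-- The difference is `(1 - ramp n t) * t`: at most `t` below `2⁻ⁿ`, and zero from there on. -/
lemma abs_sub_ramp_mul_le (n : ℕ) {t : ℝ} (ht : 0 ≤ t) : |t - ramp n t * t| ≤ (1 / 2) ^ n := by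
  have h1 : t - ramp n t * t = (1 - ramp n t) * t := by ring
  rw [h1, abs_of_nonneg (mul_nonneg (sub_nonneg.2 (ramp_le_one n t)) ht)]
  rcases le_total (2 ^ n * t) 1 with h | h
  · have h2 : t ≤ (1 / 2) ^ n := by
      rw [one_div, inv_pow, ← one_div, le_div_iff₀ (by positivity)]; linarith
    nlinarith [ramp_nonneg n t]
  · have : ramp n t = 1 := by
      have h1 : (1 : ℝ) ≤ 2 ^ (n + 1) * t - 1 := by rw [pow_succ]; linarith
      rw [ramp, min_eq_left h1, max_eq_right zero_le_one]
    rw [this, sub_self, zero_mul]; positivity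

/-- The squares of a sequence of positive contractions are dominated by multiples of a single
positive element. -/
lemma exists_dominating {u : ℕ → A} (hu0 : ∀ n, 0 ≤ u n) (hu1 : ∀ n, ‖u n‖ ≤ 1) :
    ∃ h : A, 0 ≤ h ∧ ∀ k, u k * u k ≤ (2 : ℝ) ^ k • h := by
  have hs : Summable fun k => ((1 / 2 : ℝ) ^ k) • (u k * u k) := by
    refine Summable.of_norm_bounded summable_geometric_two fun k => ?_
    rw [norm_smul, Real.norm_of_nonneg (by positivity)]
    exact mul_le_of_le_one_right (by positivity)
      ((norm_mul_le _ _).trans (mul_le_one₀ (hu1 k) (norm_nonneg _) (hu1 k)))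
  have h0 : ∀ k, 0 ≤ ((1 / 2 : ℝ) ^ k) • (u k * u k) := fun k =>
    smul_nonneg (by positivity) (by
      nth_rewrite 1 [← (hu0 k).isSelfAdjoint.star_eq]; exact star_mul_self_nonneg _)
  refine ⟨∑' k, ((1 / 2 : ℝ) ^ k) • (u k * u k), tsum_nonneg h0, fun k => ?_⟩
  have h1 := hs.le_tsum k fun j _ => h0 j
  have h2 := smul_le_smul_of_nonneg_left h1 (show (0 : ℝ) ≤ 2 ^ k by positivity)
  rwa [smul_smul, ← mul_pow, mul_one_div_cancel two_ne_zero, one_pow, one_smul] at h2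

lemma exists_isCanonicalApproxIdentity (hA : IsSigmaUnital A) :
    ∃ e : ℕ → A, IsCanonicalApproxIdentity e := by
  obtain ⟨u, hu0, hu1, hul, -⟩ := hA
  obtain ⟨h, hh, huh⟩ := exists_dominating hu0 hu1
  have hsa : IsSelfAdjoint h := hh.isSelfAdjoint
  have he0 : ∀ n, 0 ≤ cfcₙ (ramp n) h := fun n => cfcₙ_nonneg fun t _ => ramp_nonneg n t
  have hcont : ∀ n, ContinuousOn (ramp n) (quasispectrum ℝ h) := fun n =>
    (continuous_ramp n).continuousOn
  have he1 : ∀ n, ‖cfcₙ (ramp n) h‖ ≤ 1 := fun n => norm_cfcₙ_le fun t _ => by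
    rw [Real.norm_of_nonneg (ramp_nonneg n t)]; exact ramp_le_one n t
  have hlim : ∀ n, ‖h - cfcₙ (ramp n) h * h‖ ≤ (1 / 2) ^ n := fun n => by
    have h1 : h - cfcₙ (ramp n) h * h = cfcₙ (fun t => t - ramp n t * t) h := by
      rw [cfcₙ_sub (fun t : ℝ => t) (fun t => ramp n t * t) h (by fun_prop) rfl
        ((hcont n).mul continuousOn_id) (by simp),
        cfcₙ_mul (ramp n) (fun t => t) h (hcont n) (ramp_zero n) (by fun_prop) rfl, cfcₙ_id' ℝ h]
    rw [h1]
    exact norm_cfcₙ_le fun t ht => abs_sub_ramp_mul_le n (quasispectrum_nonneg_of_nonneg h hh t ht)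
  have hul' : ∀ k, Tendsto (fun n => cfcₙ (ramp n) h * u k) atTop (𝓝 (u k)) := fun k => by
    -- By the C⋆-identity the left side is the norm of `(1 - e) (u k)² (1 - e)`, which is dominated
    -- by `2 ^ k • (1 - e) h (1 - e)`. The factor `2` comes from expanding the right-hand `1 - e`.
    have key : ∀ n, ‖u k - cfcₙ (ramp n) h * u k‖ * ‖u k - cfcₙ (ramp n) h * u k‖ ≤
        2 ^ k * (2 * (1 / 2) ^ n) := fun n => by
      set e := cfcₙ (ramp n) h
      have hes : IsSelfAdjoint e := (he0 n).isSelfAdjoint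
      have hus : IsSelfAdjoint (u k) := (hu0 k).isSelfAdjoint
      have h1 := conjugate_one_sub_nonneg (sub_nonneg.2 (huh k)) hes
      have h2 : (u k - e * u k) * star (u k - e * u k) ≤
          (2 : ℝ) ^ k • (h - e * h - (h - e * h) * e) := by
        rw [← sub_nonneg]
        refine h1.trans_eq ?_
        rw [star_sub, star_mul, hes.star_eq, hus.star_eq]
        simp only [mul_sub, sub_mul, mul_smul_comm, smul_mul_assoc, smul_sub, mul_assoc]
        abel
      calc _ = ‖(u k - e * u k) * star (u k - e * u k)‖ := CStarRing.norm_self_mul_star.symm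
        _ ≤ ‖(2 : ℝ) ^ k • (h - e * h - (h - e * h) * e)‖ :=
          CStarAlgebra.norm_le_norm_of_nonneg_of_le (mul_star_self_nonneg _) h2
        _ = 2 ^ k * ‖h - e * h - (h - e * h) * e‖ := by
          rw [norm_smul, Real.norm_of_nonneg (by positivity)]
        _ ≤ 2 ^ k * (‖h - e * h‖ + ‖h - e * h‖ * 1) := by
          gcongr
          exact (norm_sub_le _ _).trans (by gcongr; exact (norm_mul_le _ _).trans (by
            gcongr; exact he1 n))
        _ ≤ _ := by rw [mul_one, ← two_mul]; gcongr; exact hlim n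
    rw [tendsto_iff_norm_sub_tendsto_zero]
    have h3 : Tendsto (fun n : ℕ => √(2 ^ k * (2 * (1 / 2 : ℝ) ^ n))) atTop (𝓝 0) := by
      have := ((tendsto_pow_atTop_nhds_zero_of_lt_one (r := (1 / 2 : ℝ)) (by norm_num)
        (by norm_num)).const_mul 2).const_mul (2 ^ k)
      have h4 := (Real.continuous_sqrt.tendsto _).comp this
      rwa [mul_zero, mul_zero, Real.sqrt_zero] at h4
    refine squeeze_zero (fun _ => norm_nonneg _) (fun n => ?_) h3
    rw [norm_sub_rev]
    exact Real.le_sqrt_of_sq_le (by rw [sq]; exact key n)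
  have hl := tendsto_mul_of_tendsto_mul he1 hul hul'
  refine ⟨fun n => cfcₙ (ramp n) h, he0, he1, fun n => ?_, hl, fun a => ?_⟩
  · rw [← cfcₙ_mul (ramp n) (ramp (n + 1)) h (hcont n) (ramp_zero n) (hcont _) (ramp_zero _)]
    exact cfcₙ_congr fun t _ => ramp_mul_succ n t
  · have := (continuous_star.tendsto _).comp (hl (star a))
    simpa [Function.comp_def, fun n => (he0 n).isSelfAdjoint.star_eq] using this

end Existence

/-! ### Lifting multipliers along a homomorphism -/

section Lifting

lemma continuous_hom {A M : Type*} [NonUnitalCStarAlgebra A] [NonUnitalCStarAlgebra M]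
    (ψ : A →⋆ₙₐ[ℂ] M) : Continuous ψ :=
  AddMonoidHomClass.continuous_of_bound ψ 1 fun b => by
    rw [one_mul]; exact NonUnitalStarAlgHom.norm_apply_le ψ b

open scoped ComplexStarModule in
lemma map_realPart {A M : Type*} [NonUnitalCStarAlgebra A] [NonUnitalCStarAlgebra M]
    (ψ : A →⋆ₙₐ[ℂ] M) (a : A) : ψ (ℜ a : A) = (ℜ (ψ a) : M) := by
  have hs : ∀ (r : ℝ) (b : A), ψ (r • b) = r • ψ b := fun r b => by
    rw [← Complex.coe_smul, map_smul, Complex.coe_smul]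
  simp [realPart_apply_coe, hs, map_star ψ a]

open scoped ComplexStarModule in
/-- A selfadjoint element of the range of a homomorphism has a selfadjoint lift which does not
have larger norm. -/
lemma exists_selfAdjoint_lift {A M : Type*} [NonUnitalCStarAlgebra A] [NonUnitalCStarAlgebra M]
    (ψ : A →⋆ₙₐ[ℂ] M) {y : M} (hy : IsSelfAdjoint y) (hr : ∃ b, ψ b = y) :
    ∃ a, IsSelfAdjoint a ∧ ψ a = y ∧ ‖a‖ ≤ ‖y‖ := by
  obtain ⟨b, rfl⟩ := hr
  have h1 : ψ (ℜ b : A) = ψ b := by rw [map_realPart, hy.coe_realPart]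
  obtain ⟨a, ha, han⟩ := exists_lift_selfAdjoint ψ (ℜ b).2
  rw [h1] at ha han
  -- The lift `a` of the right norm is not known to be selfadjoint. Its real part is, has the same
  -- image, and is not larger.
  refine ⟨ℜ a, (ℜ a).2, ?_, (realPart.norm_le a).trans han⟩
  rw [map_realPart, ha, hy.coe_realPart]

/-- Each new index is chosen beyond the threshold `N` that belongs to the previous one. -/
lemma exists_strictMono_le (N : ℕ → ℕ) : ∃ n : ℕ → ℕ, StrictMono n ∧ ∀ k, N (n k) ≤ n (k + 1) := by
  let n : ℕ → ℕ := Nat.rec 0 fun _ m => max (m + 1) (N m)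
  exact ⟨n, strictMono_nat_of_lt_succ fun k => Nat.lt_of_succ_le (le_max_left (n k + 1) (N (n k))),
    fun k => le_max_right (n k + 1) (N (n k))⟩

/-- With shift `4` the sum telescopes to four late terms minus the first four. -/
lemma norm_sum_shift_le {A : Type*} [NonUnitalCStarAlgebra A] {g : ℕ → A} (hg : ∀ n, ‖g n‖ ≤ 1) (m : ℕ) :
    ‖∑ i ∈ Finset.range m, (g (i + 4) - g i)‖ ≤ 8 := by
  have h : ∑ i ∈ Finset.range m, (g (i + 4) - g i) =
      (g m + g (m + 1) + g (m + 2) + g (m + 3)) - (g 0 + g 1 + g 2 + g 3) := by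
    induction m with
    | zero => simp
    | succ m ih => rw [Finset.sum_range_succ, ih]; simp only [add_assoc, Nat.reduceAdd]; abel
  have h4 : ∀ i j k l, ‖g i + g j + g k + g l‖ ≤ 4 := fun i j k l => by
    have h1 := norm_add₃_le (a := g i) (b := g j) (c := g k)
    have h2 := norm_add_le (g i + g j + g k) (g l)
    linarith [hg i, hg j, hg k, hg l]
  rw [h]
  exact (norm_sub_le _ _).trans ((add_le_add (h4 _ _ _ _) (h4 _ _ _ _)).trans (by norm_num))

variable {A : Type*} [NonUnitalCStarAlgebra A] [PartialOrder A] {e : ℕ → A}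

lemma IsCanonicalApproxIdentity.comp_strictMono (he : IsCanonicalApproxIdentity e) {n : ℕ → ℕ}
    (hn : StrictMono n) : IsCanonicalApproxIdentity (e ∘ n) where
  nonneg _ := he.nonneg _
  norm_le_one _ := he.norm_le_one _
  mul_succ k := he.mul_eq_of_lt (hn k.lt_succ_self)
  tendsto_mul_left a := (he.tendsto_mul_left a).comp hn.tendsto_atTop
  tendsto_mul_right a := (he.tendsto_mul_right a).comp hn.tendsto_atTop

/-- A bounded sequence whose products with every `e k` converge converges strictly from the left. -/
lemma IsCanonicalApproxIdentity.exists_tendsto_mul (he : IsCanonicalApproxIdentity e) {s : ℕ → A}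
    {K : ℝ} (hK : ∀ m, ‖s m‖ ≤ K) (h : ∀ k, ∃ w, Tendsto (fun m => s m * e k) atTop (𝓝 w)) (z : A) :
    ∃ w, Tendsto (fun m => s m * z) atTop (𝓝 w) := by
  refine cauchySeq_tendsto_of_complete (Metric.cauchySeq_iff'.2 fun ε hε => ?_)
  have hK0 : 0 ≤ K := (norm_nonneg _).trans (hK 0)
  -- `K + 1` in place of `K` keeps the denominator positive.
  obtain ⟨k, hk⟩ := (Metric.tendsto_atTop.1 (he.tendsto_mul_left z)) (ε / (3 * (K + 1)))
    (by positivity)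
  have hk := hk k le_rfl
  obtain ⟨w, hw⟩ := h k
  obtain ⟨N, hN⟩ := Metric.cauchySeq_iff'.1 (hw.mul_const z).cauchySeq (ε / 3) (by positivity)
  refine ⟨N, fun n hn => ?_⟩
  have hn := hN n hn
  rw [dist_eq_norm] at hk hn ⊢
  have h1 : ∀ m, ‖s m * (e k * z - z)‖ < ε / 3 := fun m => by
    calc _ ≤ ‖s m‖ * ‖e k * z - z‖ := norm_mul_le _ _
      _ ≤ K * ‖e k * z - z‖ := by gcongr; exact hK m
      _ ≤ (K + 1) * ‖e k * z - z‖ := by gcongr; linarith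
      _ < (K + 1) * (ε / (3 * (K + 1))) := by gcongr
      _ = ε / 3 := by field_simp
  have h2 : s n * z - s N * z =
      (s n * e k * z - s N * e k * z) - s n * (e k * z - z) + s N * (e k * z - z) := by
    noncomm_ring
  rw [h2]
  calc _ ≤ ‖s n * e k * z - s N * e k * z‖ + ‖s n * (e k * z - z)‖ + ‖s N * (e k * z - z)‖ :=
        (norm_add_le _ _).trans (by gcongr; exact norm_sub_le _ _)
    _ < ε := by linarith [h1 n, h1 N]

/-- Since `x * ψ (e k)` lies in the range of `ψ`, the products `ψ (e j) * x * ψ (e k)` form a Cauchy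
sequence in `j`. Thinning out `e` makes their oscillations summable in `k`, which controls the
off-diagonal terms of the lift. -/
lemma IsCanonicalApproxIdentity.exists_subsequence {M : Type*} [CStarAlgebra M]
    (he : IsCanonicalApproxIdentity e)
    (ψ : A →⋆ₙₐ[ℂ] M) {x : M}
    (hx : ∀ a, ∃ c, ψ c = x * ψ a) :
    ∃ n : ℕ → ℕ, StrictMono n ∧ ∀ k i j, k < i → k < j →
      ‖(ψ (e (n j)) - ψ (e (n i))) * x * ψ (e (n k))‖ ≤ (1 / 2) ^ k := by
  have h1 : ∀ k, ∃ N, ∀ i ≥ N, ∀ j ≥ N,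
      ‖(ψ (e j) - ψ (e i)) * x * ψ (e k)‖ ≤ (1 / 2) ^ k := fun k => by
    obtain ⟨c, hc⟩ := hx (e k)
    have h2 := (((continuous_hom ψ).tendsto _).comp (he.tendsto_mul_left c)).cauchySeq
    obtain ⟨N, hN⟩ := Metric.cauchySeq_iff.1 h2 ((1 / 2) ^ k) (by positivity)
    refine ⟨N, fun i hi j hj => ?_⟩
    have h3 := (hN j hj i hi).le
    rw [dist_eq_norm] at h3
    simp only [Function.comp_apply, map_mul, hc] at h3
    rwa [mul_assoc, sub_mul]
  choose N hN using h1
  obtain ⟨n, hn, hNn⟩ := exists_strictMono_le N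
  refine ⟨n, hn, fun k i j hi hj => (hN (n k) _ ?_ _ ?_).trans ?_⟩
  · exact (hNn k).trans (hn.monotone hi)
  · exact (hNn k).trans (hn.monotone hj)
  · exact pow_le_pow_of_le_one (by norm_num) (by norm_num) (hn.le_apply)

variable [StarOrderedRing A]

lemma IsCanonicalApproxIdentity.isSelfAdjoint (he : IsCanonicalApproxIdentity e) (n : ℕ) :
    IsSelfAdjoint (e n) := (he.nonneg n).isSelfAdjoint

lemma IsCanonicalApproxIdentity.mul_eq_of_gt (he : IsCanonicalApproxIdentity e) {n m : ℕ}
    (h : n < m) : e m * e n = e n := by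
  have := congrArg star (he.mul_eq_of_lt h)
  rwa [star_mul, (he.isSelfAdjoint n).star_eq, (he.isSelfAdjoint m).star_eq] at this

/-- The sums of selfadjoint elements `d * τ * d`, `d = e (i + 4) - e i`, are bounded. -/
lemma IsCanonicalApproxIdentity.norm_sum_conjugate_le (he : IsCanonicalApproxIdentity e)
    {τ : ℕ → A} (hτ : ∀ i, IsSelfAdjoint (τ i)) {C : ℝ} (hC : ∀ i, ‖τ i‖ ≤ C) (m : ℕ) :
    ‖∑ i ∈ Finset.range m, (e (i + 4) - e i) * τ i * (e (i + 4) - e i)‖ ≤ 3 * (C * 8) := by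
  have hC0 : 0 ≤ C := (norm_nonneg _).trans (hC 0)
  -- For `d = e (i + 4) - e i` one has `d * t * d ≤ ‖t‖ • d²` and `d² = e (i + 4)² - e i² - 2 (e i -
  -- e i²)`. Dropping the last term, where `e i² ≤ e i`, leaves a bound that telescopes.
  have key : ∀ (i : ℕ) (t : A), IsSelfAdjoint t → ‖t‖ ≤ C →
      (e (i + 4) - e i) * t * (e (i + 4) - e i) ≤ C • (e (i + 4) * e (i + 4) - e i * e i) := by
    intro i t ht htC
    have hd : IsSelfAdjoint (e (i + 4) - e i) := (he.isSelfAdjoint _).sub (he.isSelfAdjoint _)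
    have h1 := CStarAlgebra.star_left_conjugate_le_norm_smul (a := e (i + 4) - e i) ht
    rw [hd.star_eq] at h1
    have h2 : (e (i + 4) - e i) * (e (i + 4) - e i) =
        e (i + 4) * e (i + 4) - e i * e i - ((e i - e i * e i) + (e i - e i * e i)) := by
      have h3 := he.mul_eq_of_gt (show i < i + 4 by omega)
      have h4 := he.mul_eq_of_lt (show i < i + 4 by omega)
      rw [sub_mul, mul_sub, mul_sub, h3, h4]
      abel
    have h5 : 0 ≤ e i - e i * e i := sub_nonneg.2 (mul_self_le_self (he.nonneg i) (he.norm_le_one i))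
    have h6 : 0 ≤ (e (i + 4) - e i) * (e (i + 4) - e i) := by
      nth_rewrite 1 [← hd.star_eq]; exact star_mul_self_nonneg _
    calc _ ≤ ‖t‖ • ((e (i + 4) - e i) * (e (i + 4) - e i)) := h1
      _ ≤ C • ((e (i + 4) - e i) * (e (i + 4) - e i)) := smul_le_smul_of_nonneg_right htC h6
      _ ≤ _ := smul_le_smul_of_nonneg_left (by
        rw [h2]; exact sub_le_self _ (add_nonneg h5 h5)) hC0
  -- `key` for `τ i` and for `-τ i` traps the sum between two telescoping sums.
  have h1 := norm_le_of_le_of_neg_le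
    (s := ∑ i ∈ Finset.range m, (e (i + 4) - e i) * τ i * (e (i + 4) - e i))
    (d := ∑ i ∈ Finset.range m, C • (e (i + 4) * e (i + 4) - e i * e i))
    (Finset.sum_le_sum fun i _ => key i _ (hτ i) (hC i)) (by
      rw [neg_le, ← Finset.sum_neg_distrib]
      refine Finset.sum_le_sum fun i _ => ?_
      have := key i _ (hτ i).neg (by rw [norm_neg]; exact hC i)
      rwa [mul_neg, neg_mul] at this)
  refine h1.trans ?_
  rw [← Finset.smul_sum, norm_smul, Real.norm_of_nonneg hC0]
  gcongr
  exact norm_sum_shift_le (g := fun i => e i * e i) (fun n => (norm_mul_le _ _).trans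
    (mul_le_one₀ (he.norm_le_one n) (norm_nonneg _) (he.norm_le_one n))) m

variable {M : Type*} [CStarAlgebra M]

lemma norm_conjugate_le {v x : M} (hv : ‖v‖ ≤ 2) : ‖v * x * v‖ ≤ 4 * ‖x‖ := by
  calc ‖v * x * v‖ ≤ ‖v‖ * ‖x‖ * ‖v‖ := (norm_mul_le _ _).trans (by gcongr; exact norm_mul_le _ _)
    _ ≤ 2 * ‖x‖ * 2 := by gcongr
    _ = _ := by ring

/-- Selfadjoint elements of the idealizer of the range of a homomorphism `ψ` lift to strictly
convergent sequences. -/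
lemma IsCanonicalApproxIdentity.exists_lift_sequence_of_small (he : IsCanonicalApproxIdentity e)
    (ψ : A →⋆ₙₐ[ℂ] M) {x : M} (hxs : IsSelfAdjoint x) (hx : ∀ a, ∃ c, ψ c = x * ψ a)
    (hsmall : ∀ k i j, k < i → k < j →
      ‖(ψ (e j) - ψ (e i)) * x * ψ (e k)‖ ≤ (1 / 2) ^ k) :
    ∃ s : ℕ → A, (∀ m, IsSelfAdjoint (s m)) ∧
      (∀ z, ∃ w, Tendsto (fun m => s m * z) atTop (𝓝 w)) ∧
      ∀ m, ψ (s m) = ψ (e (m + 2)) * x * ψ (e (m + 2)) := by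
  have hE : ∀ i, IsSelfAdjoint (ψ (e i)) := fun i => (he.isSelfAdjoint i).map ψ
  have hE1 : ∀ i, ‖ψ (e i)‖ ≤ 1 := fun i =>
    (NonUnitalStarAlgHom.norm_apply_le ψ _).trans (he.norm_le_one i)
  have hd2 : ∀ i j, ‖ψ (e i) - ψ (e j)‖ ≤ 2 := fun i j =>
    (norm_sub_le _ _).trans ((add_le_add (hE1 i) (hE1 j)).trans (by norm_num))
  have hconj : ∀ a b, ∃ c, ψ c = ψ a * x * ψ b := fun a b => by
    obtain ⟨c, hc⟩ := hx b
    exact ⟨a * c, by rw [map_mul, hc, mul_assoc]⟩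
  have hconj_sa : ∀ v, IsSelfAdjoint v → IsSelfAdjoint (v * x * v) := fun v hv => by
    rw [isSelfAdjoint_iff, star_mul, star_mul, hv.star_eq, hxs.star_eq, mul_assoc]
  -- Lift of the diagonal block, which is bounded but not small: each of the two conjugates has norm
  -- at most `4 * ‖x‖`.
  have hτ : ∀ i, ∃ a, IsSelfAdjoint a ∧
      ψ a = (ψ (e (i + 3)) - ψ (e (i + 1))) * x * (ψ (e (i + 3)) - ψ (e (i + 1))) -
        (ψ (e (i + 2)) - ψ (e (i + 1))) * x * (ψ (e (i + 2)) - ψ (e (i + 1))) ∧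
      ‖a‖ ≤ 8 * ‖x‖ := fun i => by
    obtain ⟨b, hb⟩ := hconj (e (i + 3) - e (i + 1)) (e (i + 3) - e (i + 1))
    obtain ⟨c, hc⟩ := hconj (e (i + 2) - e (i + 1)) (e (i + 2) - e (i + 1))
    obtain ⟨a, ha, ha1, ha2⟩ := exists_selfAdjoint_lift ψ
      ((hconj_sa _ ((hE (i + 3)).sub (hE (i + 1)))).sub (hconj_sa _ ((hE (i + 2)).sub (hE (i + 1)))))
      ⟨b - c, by rw [map_sub, hb, hc, map_sub, map_sub]⟩
    refine ⟨a, ha, ha1, ha2.trans ((norm_sub_le _ _).trans ?_)⟩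
    linarith [norm_conjugate_le (x := x) (hd2 (i + 3) (i + 1)),
      norm_conjugate_le (x := x) (hd2 (i + 2) (i + 1))]
  -- Lift of the off-diagonal part. `hsmall` at `k = i + 1` bounds each of the two adjoint terms by
  -- `(1 / 2) ^ (i + 1)`.
  have hρ : ∀ i, ∃ a, IsSelfAdjoint a ∧
      ψ a = (ψ (e (i + 3)) - ψ (e (i + 2))) * x * ψ (e (i + 1)) +
        ψ (e (i + 1)) * x * (ψ (e (i + 3)) - ψ (e (i + 2))) ∧ ‖a‖ ≤ (1 / 2) ^ i := fun i => by
    have h1 : star ((ψ (e (i + 3)) - ψ (e (i + 2))) * x * ψ (e (i + 1))) =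
        ψ (e (i + 1)) * x * (ψ (e (i + 3)) - ψ (e (i + 2))) := by
      rw [star_mul, star_mul, star_sub, (hE _).star_eq, (hE _).star_eq, (hE _).star_eq,
        hxs.star_eq, mul_assoc]
    obtain ⟨b, hb⟩ := hconj (e (i + 3) - e (i + 2)) (e (i + 1))
    obtain ⟨c, hc⟩ := hconj (e (i + 1)) (e (i + 3) - e (i + 2))
    have h2 := hsmall (i + 1) (i + 2) (i + 3) (by omega) (by omega)
    rw [← h1]
    obtain ⟨a, ha, ha1, ha2⟩ := exists_selfAdjoint_lift ψ
      (IsSelfAdjoint.add_star_self ((ψ (e (i + 3)) - ψ (e (i + 2))) * x * ψ (e (i + 1))))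
      ⟨b + c, by rw [map_add, hb, hc, h1, map_sub]⟩
    refine ⟨a, ha, ha1, ha2.trans ((norm_add_le _ _).trans ?_)⟩
    rw [norm_star]
    calc _ ≤ (1 / 2 : ℝ) ^ (i + 1) + (1 / 2) ^ (i + 1) := add_le_add h2 h2
      _ = _ := by rw [pow_succ]; ring
  obtain ⟨s₀, hs₀, hs₀ψ, -⟩ := exists_selfAdjoint_lift ψ (hconj_sa _ (hE 2)) (hconj (e 2) (e 2))
  choose τ hτs hτψ hτn using hτ
  choose ρ hρs hρψ hρn using hρ
  have hds : ∀ i, IsSelfAdjoint (e (i + 4) - e i) := fun i =>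
    (he.isSelfAdjoint _).sub (he.isSelfAdjoint _)
  -- Compressing `τ i` by `e (i + 4) - e i` leaves its image under `ψ` unchanged. In `A` it makes
  -- the partial sums bounded and makes the `i`-th term kill every `e k` with `k < i`.
  let s : ℕ → A := fun m => s₀ + (∑ i ∈ Finset.range m, (e (i + 4) - e i) * τ i * (e (i + 4) - e i) +
    ∑ i ∈ Finset.range m, ρ i)
  have hsucc : ∀ m, s (m + 1) = s m + ((e (m + 4) - e m) * τ m * (e (m + 4) - e m) + ρ m) :=
    fun m => by
      simp only [s, Finset.sum_range_succ]; abel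
  have hbound : ∀ m, ‖s m‖ ≤ ‖s₀‖ + (3 * (8 * ‖x‖ * 8) + 2) := fun m => by
    refine (norm_add_le _ _).trans ?_
    gcongr
    refine (norm_add_le _ _).trans (add_le_add (he.norm_sum_conjugate_le hτs hτn m) ?_)
    exact (norm_sum_le_of_le _ fun i _ => hρn i).trans
      ((summable_geometric_two.sum_le_tsum _ fun i _ => by positivity).trans tsum_geometric_two.le)
  refine ⟨s, fun m => ?_, he.exists_tendsto_mul hbound fun k => ?_, fun m => ?_⟩
  · refine hs₀.add (IsSelfAdjoint.add (isSelfAdjoint_sum _ fun i _ => ?_)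
      (isSelfAdjoint_sum _ fun i _ => hρs i))
    rw [isSelfAdjoint_iff, star_mul, star_mul, (hds i).star_eq, (hτs i).star_eq, mul_assoc]
  -- Past index `k` the compressed terms vanish against `e k`, so only the geometrically small `ρ`
  -- still move `s m * e k`.
  · have h1 : ∀ m, dist (s (m + (k + 1)) * e k) (s (m + 1 + (k + 1)) * e k) ≤ 1 * (1 / 2) ^ m :=
      fun m => by
        have h2 : (e (m + (k + 1) + 4) - e (m + (k + 1))) * e k = 0 := by
          rw [sub_mul, he.mul_eq_of_gt (by omega), he.mul_eq_of_gt (by omega), sub_self]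
        have h3 : s (m + 1 + (k + 1)) * e k - s (m + (k + 1)) * e k = ρ (m + (k + 1)) * e k := by
          rw [add_right_comm m 1, hsucc, ← sub_mul, add_sub_cancel_left, add_mul, mul_assoc _ _ (e k), h2,
            mul_zero, zero_add]
        rw [dist_comm, dist_eq_norm, h3, one_mul]
        calc _ ≤ ‖ρ (m + (k + 1))‖ * ‖e k‖ := norm_mul_le _ _
          _ ≤ (1 / 2) ^ (m + (k + 1)) * 1 :=
            mul_le_mul (hρn _) (he.norm_le_one k) (norm_nonneg _) (by positivity)
          _ ≤ _ := by
            rw [mul_one]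
            exact pow_le_pow_of_le_one (by norm_num) (by norm_num) (by omega)
    obtain ⟨w, hw⟩ := cauchySeq_tendsto_of_complete
      (cauchySeq_of_le_geometric (1 / 2) 1 (by norm_num) h1)
    exact ⟨w, (tendsto_add_atTop_iff_nat (f := fun m => s m * e k) (k + 1)).1 hw⟩
  · induction m with
    | zero => simpa [s] using hs₀ψ
    | succ m ih =>
      -- Multiplication by `ψ (e (m + 4)) - ψ (e m)` subtracts `ψ (e m)` from each `ψ (e i)`
      -- strictly in between. This cancels in differences, so the element acts as a unit on the
      -- diagonal block.
      have hl : ∀ i, m < i → i < m + 4 →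
          (ψ (e (m + 4)) - ψ (e m)) * ψ (e i) = ψ (e i) - ψ (e m) := fun i h1 h2 => by
        rw [sub_mul, ← map_mul, ← map_mul, he.mul_eq_of_gt h2, he.mul_eq_of_lt h1]
      have hr : ∀ i, m < i → i < m + 4 →
          ψ (e i) * (ψ (e (m + 4)) - ψ (e m)) = ψ (e i) - ψ (e m) := fun i h1 h2 => by
        rw [mul_sub, ← map_mul, ← map_mul, he.mul_eq_of_lt h2, he.mul_eq_of_gt h1]
      have hl' : ∀ i j, m < i → i < m + 4 → m < j → j < m + 4 →
          (ψ (e (m + 4)) - ψ (e m)) * ((ψ (e i) - ψ (e j)) * x * (ψ (e i) - ψ (e j))) *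
            (ψ (e (m + 4)) - ψ (e m)) = (ψ (e i) - ψ (e j)) * x * (ψ (e i) - ψ (e j)) := by
        intro i j h1 h2 h3 h4
        have h5 : (ψ (e (m + 4)) - ψ (e m)) * (ψ (e i) - ψ (e j)) = ψ (e i) - ψ (e j) := by
          rw [mul_sub, hl i h1 h2, hl j h3 h4, sub_sub_sub_cancel_right]
        have h6 : (ψ (e i) - ψ (e j)) * (ψ (e (m + 4)) - ψ (e m)) = ψ (e i) - ψ (e j) := by
          rw [sub_mul, hr i h1 h2, hr j h3 h4, sub_sub_sub_cancel_right]
        rw [← mul_assoc, ← mul_assoc, h5, mul_assoc, h6]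
      rw [hsucc, map_add, ih, map_add, map_mul, map_mul, map_sub, hτψ, hρψ,
        mul_sub (ψ (e (m + 4)) - ψ (e m)), sub_mul _ _ (ψ (e (m + 4)) - ψ (e m)),
        hl' _ _ (by omega) (by omega) (by omega) (by omega),
        hl' _ _ (by omega) (by omega) (by omega) (by omega)]
      -- What remains is the expansion of the increment with `e (m + 3)` and `e (m + 2)` both split
      -- at `e (m + 1)`.
      rw [add_right_comm m 1 2]
      noncomm_ring

lemma IsCanonicalApproxIdentity.exists_lift_sequence (he : IsCanonicalApproxIdentity e)
    (ψ : A →⋆ₙₐ[ℂ] M) {x : M} (hxs : IsSelfAdjoint x) (hx : ∀ a, ∃ c, ψ c = x * ψ a) :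
    ∃ s : ℕ → A, (∀ m, IsSelfAdjoint (s m)) ∧
      (∀ z, ∃ w, Tendsto (fun m => s m * z) atTop (𝓝 w)) ∧
      ∀ a, Tendsto (fun m => ψ (s m) * ψ a) atTop (𝓝 (x * ψ a)) := by
  obtain ⟨n, hn, hsmall⟩ := he.exists_subsequence ψ hx
  have hf := he.comp_strictMono hn
  obtain ⟨s, hs, hconv, hsψ⟩ := hf.exists_lift_sequence_of_small ψ hxs hx hsmall
  refine ⟨s, hs, hconv, fun a => ?_⟩
  have h1 : ∀ c, Tendsto (fun m => ψ ((e ∘ n) (m + 2)) * ψ c) atTop (𝓝 (ψ c)) := fun c => by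
    have h2 := ((continuous_hom ψ).tendsto _).comp (hf.tendsto_mul_left c)
    simp only [Function.comp_def, map_mul] at h2
    exact (tendsto_add_atTop_iff_nat 2).2 h2
  obtain ⟨c, hc⟩ := hx a
  have h3 := h1 c
  have h4 := (h1 a).const_mul x
  rw [← hc] at h4 ⊢
  -- With `E = ψ ((e ∘ n) (m + 2))` and `ψ c = x * ψ a`, write `E x E ψ a = E (x E ψ a - ψ c) + E ψ
  -- c`. The first summand tends to `0` since `E` is a contraction, the second to `ψ c`.
  have h5 : Tendsto (fun m => ψ ((e ∘ n) (m + 2)) * (x * (ψ ((e ∘ n) (m + 2)) * ψ a) - ψ c))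
      atTop (𝓝 0) := by
    refine squeeze_zero_norm (fun m => ?_) (tendsto_iff_norm_sub_tendsto_zero.1 h4)
    refine (norm_mul_le _ _).trans (mul_le_of_le_one_left (norm_nonneg _) ?_)
    exact (NonUnitalStarAlgHom.norm_apply_le ψ _).trans (hf.norm_le_one _)
  have h6 := h5.add h3
  rw [zero_add] at h6
  refine h6.congr fun m => ?_
  rw [hsψ, mul_sub, sub_add_cancel]
  simp only [mul_assoc]

end Lifting

/-! ### The embedding of a C⋆-algebra in its multiplier algebra. -/

section Coe

variable {B : Type*} [NonUnitalCStarAlgebra B]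

/-- A multiplier has the same norm as its right component, so it suffices to compare right
components, and there the claim is the centrality relation. -/
lemma multiplier_mul_coe (x : 𝓜(ℂ, B)) (b : B) : x * (b : 𝓜(ℂ, B)) = (x.fst b : 𝓜(ℂ, B)) := by
  have h : (x * (b : 𝓜(ℂ, B)) - (x.fst b : 𝓜(ℂ, B))).snd = 0 :=
    ContinuousLinearMap.ext fun c => by simp [x.central]
  rw [← sub_eq_zero, ← norm_eq_zero, ← DoubleCentralizer.norm_snd, h, norm_zero]

lemma multiplier_coe_injective : Function.Injective (DoubleCentralizer.coe ℂ : B → 𝓜(ℂ, B)) :=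
  fun b c h => by
    have h1 := congrArg (fun x : 𝓜(ℂ, B) => x.fst (star (b - c))) h
    simp only [DoubleCentralizer.coe_fst, ContinuousLinearMap.mul_apply'] at h1
    rw [← sub_eq_zero, ← sub_mul] at h1
    exact sub_eq_zero.1 (CStarRing.mul_star_self_eq_zero_iff _ |>.1 h1)

end Coe

/-! ### The annihilator of the kernel of a homomorphism -/

section Annihilator

variable {A C : Type*} [NonUnitalCStarAlgebra A] [NonUnitalCStarAlgebra C]

/-- The two-sided annihilator of the kernel of a homomorphism of C⋆-algebras. -/
def kernelAnnihilator (π : A →⋆ₙₐ[ℂ] C) : NonUnitalStarSubalgebra ℂ A where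
  carrier := {z | ∀ a, π a = 0 → a * z = 0 ∧ z * a = 0}
  mul_mem' {y z} hy hz a ha :=
    ⟨by rw [← mul_assoc, (hy a ha).1, zero_mul], by rw [mul_assoc, (hz a ha).2, mul_zero]⟩
  add_mem' {y z} hy hz a ha :=
    ⟨by rw [mul_add, (hy a ha).1, (hz a ha).1, add_zero],
      by rw [add_mul, (hy a ha).2, (hz a ha).2, add_zero]⟩
  zero_mem' a _ := ⟨mul_zero a, zero_mul a⟩
  smul_mem' c z hz a ha :=
    ⟨by rw [mul_smul_comm, (hz a ha).1, smul_zero], by rw [smul_mul_assoc, (hz a ha).2, smul_zero]⟩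
  star_mem' {z} hz a ha := by
    have h := hz (star a) (by rw [map_star, ha, star_zero])
    exact ⟨by simpa using congrArg star h.2, by simpa using congrArg star h.1⟩

lemma mem_kernelAnnihilator {π : A →⋆ₙₐ[ℂ] C} {z : A} :
    z ∈ kernelAnnihilator π ↔ ∀ a, π a = 0 → a * z = 0 ∧ z * a = 0 := Iff.rfl

instance (π : A →⋆ₙₐ[ℂ] C) : IsClosed (kernelAnnihilator π : Set A) := by
  have : (kernelAnnihilator π : Set A) =
      ⋂ (a : A) (_ : π a = 0), {z | a * z = 0} ∩ {z | z * a = 0} := by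
    ext z; simp [mem_kernelAnnihilator]
  rw [this]
  exact isClosed_iInter fun a => isClosed_iInter fun _ =>
    (isClosed_eq (continuous_const_mul a) continuous_const).inter
      (isClosed_eq (continuous_mul_const a) continuous_const)

lemma mul_mem_kernelAnnihilator {π : A →⋆ₙₐ[ℂ] C} (b : A) {z : A} (hz : z ∈ kernelAnnihilator π) :
    b * z ∈ kernelAnnihilator π := fun a ha =>
  ⟨by rw [← mul_assoc]; exact (hz (a * b) (by rw [map_mul, ha, zero_mul])).1,
    by rw [mul_assoc, (hz a ha).2, mul_zero]⟩

/-- An element `w` of the annihilator that is also in the kernel satisfies `star w * w = 0`. So `π`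
is injective on this closed ⋆-subalgebra, and injective homomorphisms are isometric. -/
lemma norm_map_of_mem_kernelAnnihilator (π : A →⋆ₙₐ[ℂ] C) {z : A} (hz : z ∈ kernelAnnihilator π) :
    ‖π z‖ = ‖z‖ := by
  refine NonUnitalStarAlgHom.norm_map
    (π.comp (NonUnitalStarSubalgebraClass.subtype (kernelAnnihilator π))) ?_ ⟨z, hz⟩
  refine (injective_iff_map_eq_zero _).2 fun w hw => Subtype.ext ?_
  exact CStarRing.star_mul_self_eq_zero_iff _ |>.1
    (w.2 (star (w : A)) (by rw [map_star]; exact (congrArg star hw).trans (star_zero C))).1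

end Annihilator

/-! ### Multipliers of the Pedersen ideal -/

namespace PedersenMultipliers

variable {A : Type*} [NonUnitalCStarAlgebra A]

lemma left_mul_right (x : PedersenMultipliers A) (k : pedersenIdeal A) (a : A) :
    (x.left ⟨k * a, mul_mem_right a k.2⟩ : A) = x.left k * a := by
  refine congrArg Subtype.val (sub_eq_zero.1 (eq_zero_of_forall_mul
    (x := x.left ⟨k * a, mul_mem_right a k.2⟩ - ⟨x.left k * a, mul_mem_right a (x.left k).2⟩)
    fun y => ?_))
  rw [Submodule.coe_sub, mul_sub, x.central, ← mul_assoc, ← mul_assoc, x.central, sub_self]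

lemma ofAlgebra_mul (x : PedersenMultipliers A) (k : pedersenIdeal A) :
    ofAlgebra (k : A) * x = ofAlgebra (x.right k : A) := by
  have h := congrArg star (mul_ofAlgebra (star x) ⟨star (k : A), star_mem k.2⟩)
  simpa [left_star, ← map_star] using h

lemma left_sub (x y : PedersenMultipliers A) (k : pedersenIdeal A) :
    ((x - y).left k : A) = x.left k - y.left k := rfl

end PedersenMultipliers

/-! ### The Pedersen ideal as an increasing union of principal ideals. -/

/-- The two-sided ideal which consists of the sums of elements `a * c * b`. -/
def twoSidedSpan {A : Type*} [NonUnitalCStarAlgebra A] (c : A) : Submodule ℂ A :=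
  Submodule.span ℂ {z | ∃ a b, a * c * b = z}

lemma mul_mul_mem_twoSidedSpan {A : Type*} [NonUnitalCStarAlgebra A] (a c b : A) :
    a * c * b ∈ twoSidedSpan c := Submodule.subset_span ⟨a, b, rfl⟩

lemma twoSidedSpan_mul_mem {A : Type*} [NonUnitalCStarAlgebra A] {c x : A} (a : A)
    (hx : x ∈ twoSidedSpan c) : a * x ∈ twoSidedSpan c ∧ x * a ∈ twoSidedSpan c := by
  induction hx using Submodule.span_induction with
  | mem x hx =>
    obtain ⟨b, d, rfl⟩ := hx
    rw [mul_assoc _ d, ← mul_assoc a, ← mul_assoc a]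
    exact ⟨mul_mul_mem_twoSidedSpan _ _ _, mul_mul_mem_twoSidedSpan _ _ _⟩
  | zero => simp
  | add x y _ _ hx hy =>
    rw [mul_add, add_mul]
    exact ⟨add_mem hx.1 hy.1, add_mem hx.2 hy.2⟩
  | smul r x _ hx =>
    rw [mul_smul_comm, smul_mul_assoc]
    exact ⟨Submodule.smul_mem _ _ hx.1, Submodule.smul_mem _ _ hx.2⟩

namespace IsCanonicalApproxIdentity

variable {A : Type*} [NonUnitalCStarAlgebra A] [PartialOrder A] {e : ℕ → A}

lemma twoSidedSpan_mono (he : IsCanonicalApproxIdentity e) :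
    Monotone fun n => twoSidedSpan (e n) := by
  refine monotone_nat_of_le_succ fun n => Submodule.span_le.2 ?_
  rintro _ ⟨a, b, rfl⟩
  rw [← he.mul_succ n, ← mul_assoc]
  exact mul_mul_mem_twoSidedSpan _ _ _

/-- The Pedersen ideal is the union of the algebraic ideals generated by the `e n`. -/
lemma exists_mem_twoSidedSpan (he : IsCanonicalApproxIdentity e) {k : A}
    (hk : k ∈ pedersenIdeal A) : ∃ n, k ∈ twoSidedSpan (e n) := by
  have hdir := he.twoSidedSpan_mono.directed_le
  have hJ : IsDenseIdeal A (⨆ n, twoSidedSpan (e n)) := by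
    refine ⟨fun a x hx => ?_, fun a => ?_⟩
    · obtain ⟨n, hn⟩ := (Submodule.mem_iSup_of_directed _ hdir).1 hx
      have h1 := twoSidedSpan_mul_mem a hn
      exact ⟨Submodule.mem_iSup_of_mem n h1.1, Submodule.mem_iSup_of_mem n h1.2⟩
    · refine mem_closure_of_tendsto (he.tendsto_mul_left a) (.of_forall fun n => ?_)
      -- The index moves up by one because `e n * a = e n * e (n + 1) * a` supplies the factor
      -- needed on the left of `e (n + 1)`.
      refine Submodule.mem_iSup_of_mem (n + 1) ?_
      rw [← he.mul_succ n]
      exact mul_mul_mem_twoSidedSpan _ _ _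
  exact (Submodule.mem_iSup_of_directed _ hdir).1 (PedersenMultiplier.mem_pedersenIdeal.1 hk _ hJ)

/-! ### Control of a multiplier by its image in `M(B_n)`. -/

lemma toMultiplier_fst_toImage (he : IsCanonicalApproxIdentity e) (n : ℕ)
    (x : PedersenMultipliers A) (k : pedersenIdeal A) :
    (he.toMultiplier n x).fst (he.toImage n k) = he.toImage n (x.left k) :=
  Subtype.ext ((map_mul (he.restrict n) _ _).symm.trans
    (congrArg (he.restrict n) (PedersenMultipliers.mul_ofAlgebra x k)))

lemma toMultiplier_snd_toImage (he : IsCanonicalApproxIdentity e) (n : ℕ)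
    (x : PedersenMultipliers A) (k : pedersenIdeal A) :
    (he.toMultiplier n x).snd (he.toImage n k) = he.toImage n (x.right k) :=
  Subtype.ext ((map_mul (he.restrict n) _ _).symm.trans
    (congrArg (he.restrict n) (PedersenMultipliers.ofAlgebra_mul x k)))

/-- Multipliers of `B_n` are determined by their left action on the image of the Pedersen ideal. -/
lemma multiplier_ext (he : IsCanonicalApproxIdentity e) {n : ℕ} {x y : 𝓜(ℂ, he.image n)}
    (h : ∀ k ∈ pedersenIdeal A, x.fst (he.toImage n k) = y.fst (he.toImage n k)) : x = y := by
  have h1 : x.fst = y.fst := ContinuousLinearMap.ext fun b => by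
    obtain ⟨a, rfl⟩ := he.toImage_surjective n b
    have h2 := ((continuous_hom (he.toImage n)).tendsto _).comp (he.tendsto_mul_left a)
    refine tendsto_nhds_unique_of_eventuallyEq ((x.fst.continuous.tendsto _).comp h2)
      ((y.fst.continuous.tendsto _).comp h2) (.of_forall fun j => ?_)
    exact h _ (mul_mem_right a (he.mem_pedersenIdeal j))
  have h2 : ‖x - y‖ = 0 := by
    rw [← DoubleCentralizer.norm_fst, DoubleCentralizer.sub_fst, h1, sub_self, norm_zero]
  exact sub_eq_zero.1 (norm_eq_zero.1 h2)

lemma connectMultiplier_toMultiplier (he : IsCanonicalApproxIdentity e) {n m : ℕ} (h : n ≤ m)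
    (x : PedersenMultipliers A) :
    he.connectMultiplier h (he.toMultiplier m x) = he.toMultiplier n x :=
  he.multiplier_ext fun k hk => by
    rw [he.toMultiplier_fst_toImage n x ⟨k, hk⟩, ← he.connect_toImage h k]
    refine (extendMultiplier_fst _ _ _ _).trans ?_
    rw [he.toMultiplier_fst_toImage m x ⟨k, hk⟩, he.connect_toImage h]

/-- For `a` in the kernel, `T (a * e j)` is again in the kernel, so `a * e j * S k = T (a * e j) * k
= 0`; then let `j` tend to infinity. The factor `e j` is needed because `T` acts only on the
Pedersen ideal. On the other side `S k * a = S (k * a) = 0`. -/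
lemma left_mem_kernelAnnihilator (he : IsCanonicalApproxIdentity e) {n : ℕ}
    (x : PedersenMultipliers A) {k : pedersenIdeal A}
    (hk : (k : A) ∈ kernelAnnihilator (he.toImage n)) :
    (x.left k : A) ∈ kernelAnnihilator (he.toImage n) := fun a ha => by
  constructor
  · have h1 : ∀ j, a * (e j * (x.left k : A)) = 0 := fun j => by
      have h2 := x.central ⟨a * e j, mul_mem_left a (he.mem_pedersenIdeal j)⟩ k
      rw [← mul_assoc]
      refine h2.trans (hk _ ?_).1
      rw [← he.toMultiplier_snd_toImage, map_mul, ha, zero_mul, map_zero]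
    have h3 := (he.tendsto_mul_left (x.left k : A)).const_mul a
    simp only [h1] at h3
    exact (tendsto_nhds_unique h3 tendsto_const_nhds)
  · rw [← x.left_mul_right]
    have : (⟨k * a, mul_mem_right a k.2⟩ : pedersenIdeal A) = 0 := Subtype.ext (hk a ha).2
    rw [this, map_zero, Submodule.coe_zero]

/-- The left multiplier `S` of `x = (S, T)` is bounded by `‖φ_n x‖` on the annihilator of the kernel
of `φ_n`. -/
lemma norm_left_le (he : IsCanonicalApproxIdentity e) {n : ℕ} (x : PedersenMultipliers A)
    {k : pedersenIdeal A} (hk : (k : A) ∈ kernelAnnihilator (he.toImage n)) :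
    ‖(x.left k : A)‖ ≤ ‖he.toMultiplier n x‖ * ‖(k : A)‖ := by
  -- Both `k` and `S k` lie where `φ_n` is isometric, so the estimate may be made in `B_n`.
  rw [← norm_map_of_mem_kernelAnnihilator _ (he.left_mem_kernelAnnihilator x hk),
    ← norm_map_of_mem_kernelAnnihilator _ hk, ← he.toMultiplier_fst_toImage,
    ← DoubleCentralizer.norm_fst]
  exact ContinuousLinearMap.le_opNorm _ _

lemma left_eq_of_toMultiplier_eq (he : IsCanonicalApproxIdentity e) {n : ℕ}
    {x y : PedersenMultipliers A} (h : he.toMultiplier n x = he.toMultiplier n y)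
    {k : pedersenIdeal A} (hk : (k : A) ∈ kernelAnnihilator (he.toImage n)) :
    x.left k = y.left k := by
  have h1 := he.norm_left_le (x - y) hk
  rw [map_sub, h, sub_self, norm_zero, zero_mul, PedersenMultipliers.left_sub] at h1
  exact Subtype.ext (sub_eq_zero.1 (norm_le_zero_iff.1 h1))

lemma right_eq_of_toMultiplier_eq (he : IsCanonicalApproxIdentity e) {n : ℕ}
    {x y : PedersenMultipliers A} (h : he.toMultiplier n x = he.toMultiplier n y)
    {k : pedersenIdeal A} (hk : (k : A) ∈ kernelAnnihilator (he.toImage n)) :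
    x.right k = y.right k := by
  have h1 := congrArg (fun t : pedersenIdeal A => star (t : A))
    (he.left_eq_of_toMultiplier_eq (x := star x) (y := star y) (by rw [map_star, map_star, h])
      (k := ⟨star (k : A), star_mem k.2⟩) (StarMemClass.star_mem hk))
  simpa [PedersenMultipliers.left_star] using h1

/-- A strictly convergent sequence of selfadjoint elements defines a multiplier of the Pedersen
ideal. -/
lemma exists_multiplier_of_tendsto (he : IsCanonicalApproxIdentity e) {s : ℕ → A}
    (hs : ∀ m, IsSelfAdjoint (s m)) (hconv : ∀ z, ∃ w, Tendsto (fun m => s m * z) atTop (𝓝 w)) :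
    ∃ x : PedersenMultipliers A, ∀ k : pedersenIdeal A,
      Tendsto (fun m => s m * k) atTop (𝓝 (x.left k : A)) := by
  have h1 : ∀ k : pedersenIdeal A, ∃ w : pedersenIdeal A,
      Tendsto (fun m => s m * k) atTop (𝓝 (w : A)) := by
    rintro ⟨k, hk⟩
    obtain ⟨n, hn⟩ := he.exists_mem_twoSidedSpan hk
    suffices ∃ w ∈ pedersenIdeal A, Tendsto (fun m => s m * k) atTop (𝓝 w) by
      obtain ⟨w, hw, h⟩ := this
      exact ⟨⟨w, hw⟩, h⟩
    clear hk
    induction hn using Submodule.span_induction with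
    | mem x hx =>
      obtain ⟨a, b, rfl⟩ := hx
      obtain ⟨w, hw⟩ := hconv a
      -- The limit stays in the Pedersen ideal because the factor `e n` survives: only `s m * a` has
      -- to converge.
      refine ⟨w * e n * b, mul_mem_right b (mul_mem_left w (he.mem_pedersenIdeal n)), ?_⟩
      simpa only [mul_assoc] using (hw.mul_const (e n)).mul_const b
    | zero => exact ⟨0, Submodule.zero_mem _, by simp⟩
    | add x y _ _ hx hy =>
      obtain ⟨v, hv, hv'⟩ := hx
      obtain ⟨w, hw, hw'⟩ := hy
      exact ⟨v + w, add_mem hv hw, by simpa only [mul_add] using hv'.add hw'⟩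
    | smul r x _ hx =>
      obtain ⟨v, hv, hv'⟩ := hx
      exact ⟨r • v, Submodule.smul_mem _ _ hv, by
        simpa only [mul_smul_comm] using hv'.const_smul r⟩
  choose S hS using h1
  -- Since the `s m` are selfadjoint, the right multiplier is the conjugate of `S`, and both sides
  -- of the centrality relation are limits of `y * s m * z`.
  obtain ⟨x, hx, -⟩ := PedersenMultipliers.exists_of_functions S
    (fun k => ⟨star (S ⟨star (k : A), star_mem k.2⟩ : A), star_mem (S _).2⟩) fun y z => by
      have h2 := (hS z).const_mul (y : A)
      have h3 := ((continuous_star.tendsto _).comp (hS ⟨star (y : A), star_mem y.2⟩)).mul_const (z : A)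
      refine tendsto_nhds_unique_of_eventuallyEq h2 h3 (.of_forall fun m => ?_)
      simp [(hs m).star_eq, mul_assoc]
  exact ⟨x, fun k => by rw [hx]; exact hS k⟩

/-! ### The map to the inverse limit and its continuity. -/

/-- The homomorphism `x ↦ (φ_n x)` from `Γ(K(A))` to the inverse limit of the `M(B_n)`. -/
noncomputable def toInverseLimit (he : IsCanonicalApproxIdentity e) :
    PedersenMultipliers A →⋆ₐ[ℂ] he.inverseLimit where
  toFun x := ⟨fun n => he.toMultiplier n x, fun _ _ h => he.connectMultiplier_toMultiplier h x⟩
  map_one' := Subtype.ext (funext fun n => map_one (he.toMultiplier n))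
  map_mul' x y := Subtype.ext (funext fun n => map_mul (he.toMultiplier n) x y)
  map_zero' := Subtype.ext (funext fun n => map_zero (he.toMultiplier n))
  map_add' x y := Subtype.ext (funext fun n => map_add (he.toMultiplier n) x y)
  commutes' c := Subtype.ext (funext fun n => AlgHomClass.commutes (he.toMultiplier n) c)
  map_star' x := Subtype.ext (funext fun n => map_star (he.toMultiplier n) x)

lemma toInverseLimit_apply (he : IsCanonicalApproxIdentity e) (x : PedersenMultipliers A) (n : ℕ) :
    (he.toInverseLimit x : ∀ n, 𝓜(ℂ, he.image n)) n = he.toMultiplier n x := rfl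

/-- The norm in `M(B_n)` is at most that of `S` on `L_{e n}`. Every `z` there equals `z * e (n +
1)`, so it lies in `A * e (n + 1)` itself, not just in a closure; hence the index `n + 1`. -/
lemma norm_toMultiplier_le (he : IsCanonicalApproxIdentity e) (n : ℕ) (x : PedersenMultipliers A)
    {C : ℝ} (hC : 0 ≤ C) (h : ∀ k : pedersenIdeal A, (∃ b : A, b * e (n + 1) = k) → ‖(k : A)‖ ≤ 1 →
      ‖(x.left k : A)‖ ≤ C) : ‖he.toMultiplier n x‖ ≤ C := by
  have h1 : ‖he.toMultiplier n x‖ ≤ ‖he.restrict n x‖ := by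
    rw [← DoubleCentralizer.norm_fst]
    exact ContinuousLinearMap.opNorm_le_bound _ (norm_nonneg _) fun b =>
      norm_mul_le (he.restrict n x) (b : RestrictedMultipliers (e n))
  rw [RestrictedMultipliers.norm_eq_norm_left] at h1
  refine h1.trans (ContinuousLinearMap.opNorm_le_of_unit_norm hC fun z hz => ?_)
  exact h ⟨z, he.leftIdeal_le n z.2⟩ ⟨z, he.leftIdeal_mul n.lt_succ_self z.2⟩ hz.le

lemma continuous_toMultiplier (he : IsCanonicalApproxIdentity e) (n : ℕ) :
    Continuous (he.toMultiplier n) := by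
  refine continuous_iff_continuousAt.2 fun x₀ => Metric.tendsto_nhds.2 fun ε hε => ?_
  have h1 := UniformOnFun.tendsto_iff_tendstoUniformlyOn.1
    ((continuous_induced_dom (f := fun x : PedersenMultipliers A =>
      UniformOnFun.ofFun (PedersenMultipliers.topologyFamily A) fun y => (x.left y : A))).tendsto x₀)
    _ ⟨e (n + 1), he.mem_pedersenIdeal _, he.nonneg _, rfl⟩
  filter_upwards [Metric.tendstoUniformlyOn_iff.1 h1 (ε / 2) (by positivity)] with x hx
  rw [dist_eq_norm, ← map_sub]
  refine (he.norm_toMultiplier_le n _ (C := ε / 2) (by positivity) fun k hk1 hk2 => ?_).trans_lt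
    (by linarith)
  have h2 := (hx k ⟨hk1, hk2⟩).le
  rw [dist_comm, dist_eq_norm] at h2
  exact h2

variable [StarOrderedRing A]

/-- If `φ_n a = 0`, then `a` kills `L_{e n}` by left and `R_{e n}` by right multiplication, in
particular all `c * e n` and `e n * d`. -/
lemma twoSidedSpan_le_kernelAnnihilator (he : IsCanonicalApproxIdentity e) (n : ℕ) {z : A}
    (hz : z ∈ twoSidedSpan (e n)) : z ∈ kernelAnnihilator (he.toImage n) := by
  refine (Submodule.span_le (p := (kernelAnnihilator (he.toImage n)).toSubmodule)).2 ?_ hz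
  rintro _ ⟨c, d, rfl⟩ a ha
  have h0 : he.restrictAlgebra n a = 0 := congrArg Subtype.val ha
  constructor
  · have h1 : a * (c * e n) = 0 := by
      rw [← he.restrictAlgebra_left n a ⟨c * e n, mul_mem_leftIdeal c (e n)⟩, h0]; rfl
    rw [← mul_assoc, h1, zero_mul]
  · have h2 : e n * d ∈ rightIdeal (star (e n)) := by
      rw [(he.isSelfAdjoint n).star_eq]; exact mul_mem_rightIdeal (e n) d
    have h1 : e n * d * a = 0 := by
      rw [← he.restrictAlgebra_right n a ⟨e n * d, h2⟩, h0]; rfl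
    rw [mul_assoc c, mul_assoc, h1, mul_zero]

lemma exists_mem_kernelAnnihilator (he : IsCanonicalApproxIdentity e) {k : A}
    (hk : k ∈ pedersenIdeal A) : ∃ N, ∀ n ≥ N, k ∈ kernelAnnihilator (he.toImage n) := by
  obtain ⟨N, hN⟩ := he.exists_mem_twoSidedSpan hk
  exact ⟨N, fun n hn => he.twoSidedSpan_le_kernelAnnihilator n (he.twoSidedSpan_mono hn hN)⟩

/-! ### Surjectivity of `Γ(K(A)) → M(B_n)` -/

/-- The lifting result is applied to `A → B_n → M(B_n)`. The strict limit of the lifted sequence is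
the multiplier `y`; on the image of the Pedersen ideal, `φ_n y` and `x` are limits of the same
sequence. -/
lemma exists_toMultiplier_eq_of_isSelfAdjoint (he : IsCanonicalApproxIdentity e) (n : ℕ)
    {x : 𝓜(ℂ, he.image n)} (hx : IsSelfAdjoint x) : ∃ y, he.toMultiplier n y = x := by
  let ψ : A →⋆ₙₐ[ℂ] 𝓜(ℂ, he.image n) :=
    (DoubleCentralizer.coeHom (𝕜 := ℂ) (A := he.image n)).comp (he.toImage n)
  obtain ⟨s, hs, hconv, hlim⟩ := he.exists_lift_sequence ψ hx fun a => by
    obtain ⟨c, hc⟩ := he.toImage_surjective n (x.fst (he.toImage n a))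
    exact ⟨c, (congrArg (DoubleCentralizer.coe ℂ) hc).trans (multiplier_mul_coe x _).symm⟩
  obtain ⟨y, hy⟩ := he.exists_multiplier_of_tendsto hs hconv
  refine ⟨y, he.multiplier_ext fun k hk => ?_⟩
  rw [he.toMultiplier_fst_toImage n y ⟨k, hk⟩]
  have h1 := ((continuous_hom ψ).tendsto _).comp (hy ⟨k, hk⟩)
  have h2 : ψ (y.left ⟨k, hk⟩) = x * ψ k :=
    tendsto_nhds_unique_of_eventuallyEq h1 (hlim k) (.of_forall fun m => map_mul ψ _ _)
  exact multiplier_coe_injective (h2.trans (multiplier_mul_coe x _))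

open scoped ComplexStarModule in
lemma toMultiplier_surjective (he : IsCanonicalApproxIdentity e) (n : ℕ) :
    Function.Surjective (he.toMultiplier n) := fun x => by
  obtain ⟨y, hy⟩ := he.exists_toMultiplier_eq_of_isSelfAdjoint n (ℜ x).2
  obtain ⟨z, hz⟩ := he.exists_toMultiplier_eq_of_isSelfAdjoint n (ℑ x).2
  exact ⟨y + Complex.I • z, by
    rw [map_add, map_smul, hy, hz, realPart_add_I_smul_imaginaryPart]⟩

/-! ### The isomorphism with the inverse limit -/

lemma toInverseLimit_injective (he : IsCanonicalApproxIdentity e) :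
    Function.Injective he.toInverseLimit := fun x y hxy => by
  have h1 : ∀ n, he.toMultiplier n x = he.toMultiplier n y := fun n =>
    congrFun (congrArg Subtype.val hxy) n
  refine PedersenMultipliers.ext (fun k => ?_) fun k => ?_
  all_goals obtain ⟨N, hN⟩ := he.exists_mem_kernelAnnihilator k.2
  · rw [he.left_eq_of_toMultiplier_eq (h1 N) (hN N le_rfl)]
  · rw [he.right_eq_of_toMultiplier_eq (h1 N) (hN N le_rfl)]

lemma toInverseLimit_surjective (he : IsCanonicalApproxIdentity e) :
    Function.Surjective he.toInverseLimit := fun u => by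
  choose y hy using fun n => he.toMultiplier_surjective n (u.1 n)
  have hym : ∀ n m, n ≤ m → he.toMultiplier n (y m) = u.1 n := fun n m h => by
    rw [← he.connectMultiplier_toMultiplier h, hy, u.2 n m h]
  -- The lifts `y m` need not be compatible with each other, but once `k` lies in the annihilator at
  -- level `N`, the value at `k` depends only on `φ_N (y m) = u N`.
  have hS : ∀ k : pedersenIdeal A, ∃ w, ∃ N, ∀ m ≥ N, (y m).left k = w := fun k => by
    obtain ⟨N, hN⟩ := he.exists_mem_kernelAnnihilator k.2
    exact ⟨(y N).left k, N, fun m hm => he.left_eq_of_toMultiplier_eq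
      (by rw [hym N m hm, hy]) (hN N le_rfl)⟩
  have hT : ∀ k : pedersenIdeal A, ∃ w, ∃ N, ∀ m ≥ N, (y m).right k = w := fun k => by
    obtain ⟨N, hN⟩ := he.exists_mem_kernelAnnihilator k.2
    exact ⟨(y N).right k, N, fun m hm => he.right_eq_of_toMultiplier_eq
      (by rw [hym N m hm, hy]) (hN N le_rfl)⟩
  choose S N hSN using hS
  choose T N' hTN using hT
  obtain ⟨x, hx, -⟩ := PedersenMultipliers.exists_of_functions S T fun j k => by
    -- One index beyond both thresholds realizes `T j` and `S k` by the same multiplier, whose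
    -- centrality applies.
    rw [← hTN j _ (le_max_right (N k) _), ← hSN k _ (le_max_left _ (N' j))]
    exact (y _).central j k
  refine ⟨x, Subtype.ext (funext fun n => he.multiplier_ext fun k hk => ?_)⟩
  rw [toInverseLimit_apply, he.toMultiplier_fst_toImage n x ⟨k, hk⟩, hx,
    ← hSN _ _ (le_max_left (N ⟨k, hk⟩) n), ← hym n _ (le_max_right (N ⟨k, hk⟩) n),
    he.toMultiplier_fst_toImage n _ ⟨k, hk⟩]

/-- The annihilator is a left ideal, so one `n` serves the whole set `A * a`, and each seminorm of
the projective topology is dominated by a single `‖φ_n ·‖`. -/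
lemma continuous_of_continuous_toMultiplier (he : IsCanonicalApproxIdentity e) {X : Type*}
    [TopologicalSpace X] {f : X → PedersenMultipliers A}
    (hf : ∀ n, Continuous fun u => he.toMultiplier n (f u)) : Continuous f := by
  refine continuous_induced_rng.2 (continuous_iff_continuousAt.2 fun u₀ => ?_)
  refine UniformOnFun.tendsto_iff_tendstoUniformlyOn.2 ?_
  rintro _ ⟨a, ha, -, rfl⟩
  obtain ⟨n, hn⟩ := he.exists_mem_kernelAnnihilator ha
  refine Metric.tendstoUniformlyOn_iff.2 fun ε hε => ?_
  filter_upwards [Metric.tendsto_nhds.1 ((hf n).tendsto u₀) ε hε] with u hu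
  rintro k ⟨⟨b, hb⟩, hk⟩
  have hkn : (k : A) ∈ kernelAnnihilator (he.toImage n) := by
    rw [← hb]; exact mul_mem_kernelAnnihilator b (hn n le_rfl)
  rw [dist_eq_norm, ← map_sub] at hu
  rw [dist_comm, dist_eq_norm]
  calc _ ≤ ‖he.toMultiplier n (f u - f u₀)‖ * ‖(k : A)‖ := he.norm_left_le (f u - f u₀) hkn
    _ ≤ ‖he.toMultiplier n (f u - f u₀)‖ := mul_le_of_le_one_right (norm_nonneg _) hk
    _ < ε := hu

end IsCanonicalApproxIdentity

end PedersenMultiplier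

theorem proposition3p2 {A : Type*} [NonUnitalCStarAlgebra A] [PartialOrder A] [StarOrderedRing A]
    (hA : PedersenMultiplier.IsSigmaUnital A) :
    (∃ e : ℕ → A, PedersenMultiplier.IsCanonicalApproxIdentity e) ∧
    ∀ (e : ℕ → A) (he : PedersenMultiplier.IsCanonicalApproxIdentity e),
      (∃ Ψ : PedersenMultiplier.PedersenMultipliers A ≃⋆ₐ[ℂ] he.inverseLimit,
        Continuous Ψ ∧ Continuous Ψ.symm ∧
        ∀ (x : PedersenMultiplier.PedersenMultipliers A) (n : ℕ),
          (Ψ x : ∀ n, 𝓜(ℂ, he.image n)) n = he.toMultiplier n x) ∧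
      ∀ n : ℕ, Function.Surjective (he.toMultiplier n) := by
  refine ⟨PedersenMultiplier.exists_isCanonicalApproxIdentity hA, fun e he =>
    ⟨⟨StarAlgEquiv.ofBijective he.toInverseLimit
      ⟨he.toInverseLimit_injective, he.toInverseLimit_surjective⟩, ?_, ?_, fun _ _ => rfl⟩,
      he.toMultiplier_surjective⟩⟩
  · exact Continuous.subtype_mk (continuous_pi fun n => he.continuous_toMultiplier n) _
  · refine he.continuous_of_continuous_toMultiplier fun n => ?_
    refine ((continuous_apply n).comp continuous_subtype_val).congr fun u => ?_
    conv_lhs => rw [← StarAlgEquiv.apply_symm_apply (StarAlgEquiv.ofBijective he.toInverseLimit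
      ⟨he.toInverseLimit_injective, he.toInverseLimit_surjective⟩) u]
    rfl
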